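/- Let $m\ge 2$, $n\ge 0$ be integers, let $B\in\mathbb R^{m\times n}$ have all columns of Euclidean norm at most $1$, let $p\in(0,1)^n$, $\eta>0$ and $\epsilon\in(0,1)$. A random vector $z\in\{\pm1\}^n$ is called feasible if $\Pr(z_i=1)=p_i$ and $\Pr(z_i=-1)=1-p_i$ for all $i$. Write $\mathrm{Cov}(y)=\mathbb E[(y-\mathbb E y)(y-\mathbb E y)^\top]$, $\langle X,Y\rangle=\mathrm{tr}(XY^\top)$, and let $\|\cdot\|$ be the operator norm induced by the Euclidean norm. Suppose we have access to a randomized oracle $\mathcal O$ which, for every (symmetric) positive definite $W\in\mathbb R^{m\times m}$, returns a fresh feasible random vector $z'\leftarrow\mathcal O(B,W,p)$ with $$\langle \mathrm{Cov}(Bz'),W\rangle\le \eta\,\mathrm{tr}(W).$$ Algorithm MWU$(B,p,\mathcal O,\eta,\epsilon)$: set $W_0=I$, $\alpha=0$, $t=1$. While $\alpha<\frac{2\ln m}{\epsilon\eta}$: draw $z_t\leftarrow\mathcal O(B,W_{t-1},p)$, let $M_t=\mathrm{Cov}(Bz_t)$ be the covariance matrix of $Bz_t$ given $W_{t-1}$,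 put $\alpha_t=\frac{\epsilon}{6\|M_t\|}$ (if $M_t=0$, so that $\alpha_t=\infty$, stop and return $z_t$), $W_t=\exp\big(\sum_{\tau\le t}\alpha_\tau M_\tau\big)$, and replace $\alpha$ by $\alpha+\alpha_t$ and $t$ by $t+1$. After the loop, return $z=z_\tau$ with probability $\alpha_\tau/\alpha$, $\tau=1,\dots,t-1$. (a) (Explicit covariances.) If the matrices $\mathrm{Cov}(Bz_t)$ are available in explicit form, the algorithm always terminates and returns a feasible random vector $z$ with $$\|\mathrm{Cov}(Bz)\|\le(1+\epsilon)\eta,$$ and the number of calls to $\mathcal O$ and the running time are bounded by a polynomial in $m,n,\epsilon^{-1}$. (b) (Empirical covariances.) Suppose that, instead, $M_t$ is replaced by $\widetilde M_t=\frac1N\sum_{k=1}^N B(z_{t,k}-z_0)(z_{t,k}-z_0)^\top B^\top$, where $z_0=2p-\mathbf 1$ and $z_{t,1},\dots,z_{t,N}\leftarrow\mathcal O(B,W_{t-1},p)$ are independent samples, independent also of $z_t$. There is a polynomial $P$ in $m,n,\epsilon^{-1},\eta^{-1}$ such that for every integer $N\ge P$ the algorithm always terminates and returns a feasible random vector $z$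 with $\|\mathrm{Cov}(Bz)\|\le(1+\epsilon)\eta$, and the number of calls to $\mathcal O$ and the running time are at most $N$ times a polynomial in $m,n,\epsilon^{-1},\eta^{-1}$. The polynomials are universal (they depend on nothing else). Running time is counted in exact real arithmetic: a scalar operation costs one step, an oracle call costs the transfer of its input and output, and an evaluation of the matrix exponential or of the operator norm of a symmetric $m\times m$ matrix costs $\kappa$ steps, where the bounds on the running time hold for every $\kappa\in\mathbb N$ with an additional factor $\kappa+1$ (so the running time is polynomial whenever $\kappa$ is polynomial in $m$). -/

import Mathlib

open scoped Matrix

noncomputable section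

namespace MWU

/-! ## Random assignments, covariance, oracles -/

/-- Assignments `z ∈ {±1}ⁿ`. -/
abbrev Assignment (n : ℕ) : Type := Fin n → ℤˣ

/-- The assignment as a real vector. -/
def toVec {n : ℕ} (z : Assignment n) : Fin n → ℝ := fun i => ((z i : ℤ) : ℝ)

/-- `μ` is feasible: `Pr(z_i = 1) = p_i` and `Pr(z_i = -1) = 1 - p_i` for every `i`. -/
def Feasible {n : ℕ} (p : Fin n → ℝ) (μ : PMF (Assignment n)) : Prop :=
  ∀ i, μ.map (fun z => z i) 1 = ENNReal.ofReal (p i) ∧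
    μ.map (fun z => z i) (-1) = ENNReal.ofReal (1 - p i)

/-- The expectation of the random vector `y z`, `z ∼ μ`. -/
def mean {m n : ℕ} (μ : PMF (Assignment n)) (y : Assignment n → Fin m → ℝ) : Fin m → ℝ :=
  ∑ z, (μ z).toReal • y z

/-- The covariance matrix `E[(y - E y)(y - E y)ᵀ]` of the random vector `y z`, `z ∼ μ`. -/
def cov {m n : ℕ} (μ : PMF (Assignment n)) (y : Assignment n → Fin m → ℝ) :
    Matrix (Fin m) (Fin m) ℝ :=
  ∑ z, (μ z).toReal • Matrix.vecMulVec (y z - mean μ y) (y z - mean μ y)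

/-- `Cov(B z)` for `z ∼ μ`. -/
def covB {m n : ℕ} (B : Matrix (Fin m) (Fin n) ℝ) (μ : PMF (Assignment n)) :
    Matrix (Fin m) (Fin m) ℝ :=
  cov μ (fun z => B *ᵥ toVec z)

/-- The operator norm of a square matrix induced by the Euclidean norm. -/
def opNorm {m : ℕ} (A : Matrix (Fin m) (Fin m) ℝ) : ℝ :=
  ‖Matrix.toEuclideanCLM (n := Fin m) (𝕜 := ℝ) A‖

/-- `‖B‖_{1,2} ≤ 1`: every column of `B` has Euclidean norm at most one. -/
def ColumnsLeOne {m n : ℕ} (B : Matrix (Fin m) (Fin n) ℝ) : Prop :=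
  ∀ j, ‖WithLp.toLp 2 (fun i => B i j)‖ ≤ 1

/-- A randomized oracle `𝒪(B, W, p)`: each call returns a fresh sample of the indicated law. -/
abbrev Oracle (m n : ℕ) : Type :=
  Matrix (Fin m) (Fin n) ℝ → Matrix (Fin m) (Fin m) ℝ → (Fin n → ℝ) → PMF (Assignment n)

/-- On the inputs `B`, `p` and every positive definite `W`, the oracle returns a feasible `z'` with
`⟨Cov(B z'), W⟩ ≤ η · tr W`, where `⟨X, Y⟩ = tr(X Yᵀ)`. -/
def IsOracle {m n : ℕ} (O : Oracle m n) (B : Matrix (Fin m) (Fin n) ℝ) (p : Fin n → ℝ)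
    (η : ℝ) : Prop :=
  ∀ W : Matrix (Fin m) (Fin m) ℝ, W.PosDef →
    Feasible p (O B W p) ∧ (covB B (O B W p) * Wᵀ).trace ≤ η * W.trace

/-! ## Randomized computations with a step count

The model is exact real arithmetic. A computation records the number of oracle calls, the number of
elementary steps (scalar operations, comparisons, logarithms, data movements; a matrix operation is
charged for its scalar operations, an oracle call for the transfer of its input and output), and the
number of evaluations of the two spectral functions of `m × m` symmetric matrices: matrix
exponential and operator norm. -/

/-- Resources used by a computation. -/
structure Cost where
  calls : ℕ
  steps : ℕ
  spectral : ℕ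

/-- Resources used by one computation after another. -/
def Cost.add (c d : Cost) : Cost :=
  ⟨c.calls + d.calls, c.steps + d.steps, c.spectral + d.spectral⟩

/-- The running time, when one evaluation of a spectral function is charged `κ` steps. -/
def Cost.time (κ : ℕ) (c : Cost) : ℕ := c.steps + κ * c.spectral

/-- A randomized computation: the joint law of its result and the resources used. -/
structure Comp (α : Type) where
  law : PMF (α × Cost)

instance : Monad Comp where
  pure a := ⟨PMF.pure (a, ⟨0, 0, 0⟩)⟩
  bind x f := ⟨x.law.bind fun r => (f r.1).law.map fun q => (q.1, Cost.add r.2 q.2)⟩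

/-- Compute `a` in `k` elementary steps. -/
def op {α : Type} (k : ℕ) (a : α) : Comp α := ⟨PMF.pure (a, ⟨0, k, 0⟩)⟩

/-- Compute `a` by one evaluation of a spectral function. -/
def spectralOp {α : Type} (a : α) : Comp α := ⟨PMF.pure (a, ⟨0, 0, 1⟩)⟩

/-- One call of the oracle. -/
def query {m n : ℕ} (O : Oracle m n) (B : Matrix (Fin m) (Fin n) ℝ)
    (W : Matrix (Fin m) (Fin m) ℝ) (p : Fin n → ℝ) : Comp (Assignment n) :=
  ⟨(O B W p).map fun z => (z, ⟨1, m * n + m * m + 2 * n + 1, 0⟩)⟩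

/-- Sample from a list of pairs `(α_τ, z_τ)`, choosing entry `τ` with probability `α_τ / α`; the
computation fails (returns `none`) if these numbers do not form a probability vector, in particular
if the list is empty. -/
def draw {n : ℕ} (α : ℝ) (h : List (ℝ × Assignment n)) : Comp (Option (Assignment n)) :=
  open Classical in
  if hw : ∑ τ : Fin h.length, ENNReal.ofReal ((h.get τ).1 / α) = 1 then
    ⟨(PMF.ofFintype (fun τ : Fin h.length => ENNReal.ofReal ((h.get τ).1 / α)) hw).map
      fun τ => (some (h.get τ).2, ⟨0, 2 * h.length + 1, 0⟩)⟩
  else op 1 none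

/-! ## The covariance matrices used by the algorithm -/

/-- The covariance matrix of the oracle's output on `W` is available in explicit form. -/
def exactCov {m n : ℕ} (O : Oracle m n) (B : Matrix (Fin m) (Fin n) ℝ) (p : Fin n → ℝ)
    (W : Matrix (Fin m) (Fin m) ℝ) : Comp (Matrix (Fin m) (Fin m) ℝ) :=
  op (m * m) (covB B (O B W p))

/-- `∑_{k ≤ N} B (z_k - z₀)(z_k - z₀)ᵀ Bᵀ` for `N` independent samples `z_k` of the oracle on `W`,
where `z₀ = 2p - 1`. -/
def scatter {m n : ℕ} (O : Oracle m n) (B : Matrix (Fin m) (Fin n) ℝ) (p : Fin n → ℝ)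
    (W : Matrix (Fin m) (Fin m) ℝ) : ℕ → Comp (Matrix (Fin m) (Fin m) ℝ)
  | 0 => op (m * m) 0
  | k + 1 => do
    let S ← scatter O B p W k
    let z ← query O B W p
    let d ← op (3 * n) (fun i => toVec z i - (2 * p i - 1))
    let y ← op (2 * m * n) (B *ᵥ d)
    op (2 * m * m) (S + Matrix.vecMulVec y y)

/-- The empirical estimate of the covariance matrix from `N` independent samples. -/
def empiricalCov {m n : ℕ} (N : ℕ) (O : Oracle m n) (B : Matrix (Fin m) (Fin n) ℝ)
    (p : Fin n → ℝ) (W : Matrix (Fin m) (Fin m) ℝ) : Comp (Matrix (Fin m) (Fin m) ℝ) := do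
  let S ← scatter O B p W N
  op (m * m + 1) ((N : ℝ)⁻¹ • S)

/-! ## The algorithm -/

/-- The variables of the algorithm after `t` iterations: `W = W_t`, `S = ∑_{τ ≤ t} α_τ M_τ`,
`α = ∑_{τ ≤ t} α_τ` and the list of all `(α_τ, z_τ)`. -/
structure State (m n : ℕ) where
  W : Matrix (Fin m) (Fin m) ℝ
  S : Matrix (Fin m) (Fin m) ℝ
  α : ℝ
  hist : List (ℝ × Assignment n)

/-- One iteration of the while loop. `cv W` yields the matrix `M_t` (the covariance matrix of the
oracle's output on `W`, or an estimate of it). The sample `z_t` is drawn independently of `M_t`.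
If `M_t = 0`, then `α_t = ε / (6‖M_t‖)` is infinite, and the algorithm stops and returns `z_t`. -/
def iteration {m n : ℕ} (O : Oracle m n) (B : Matrix (Fin m) (Fin n) ℝ) (p : Fin n → ℝ) (ε : ℝ)
    (cv : Matrix (Fin m) (Fin m) ℝ → Comp (Matrix (Fin m) (Fin m) ℝ)) (s : State m n) :
    Comp (State m n ⊕ Assignment n) := do
  let z ← query O B s.W p
  let M ← cv s.W
  let ν ← spectralOp (opNorm M)
  if ν = 0 then op 1 (Sum.inr z)
  else do
    let a ← op 3 (ε / (6 * ν))
    let S ← op (2 * m * m) (s.S + a • M)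
    let W ← spectralOp (NormedSpace.exp S)
    op (n + 2) (Sum.inl ⟨W, S, s.α + a, (a, z) :: s.hist⟩)

/-- The while loop followed by the final sampling; `none` if the loop is not left within the given
number of rounds. -/
def loop {m n : ℕ} (O : Oracle m n) (B : Matrix (Fin m) (Fin n) ℝ) (p : Fin n → ℝ) (η ε : ℝ)
    (cv : Matrix (Fin m) (Fin m) ℝ → Comp (Matrix (Fin m) (Fin m) ℝ)) :
    ℕ → State m n → Comp (Option (Assignment n))
  | 0, _ => pure none
  | T + 1, s => do
    let θ ← op 5 (2 * Real.log m / (ε * η))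
    if s.α < θ then do
      let r ← iteration O B p ε cv s
      match r with
      | Sum.inl s' => loop O B p η ε cv T s'
      | Sum.inr z => pure (some z)
    else draw s.α s.hist

/-- The algorithm, run for at most `T` rounds of its loop. -/
def run {m n : ℕ} (O : Oracle m n) (B : Matrix (Fin m) (Fin n) ℝ) (p : Fin n → ℝ) (η ε : ℝ)
    (cv : Matrix (Fin m) (Fin m) ℝ → Comp (Matrix (Fin m) (Fin m) ℝ)) (T : ℕ) :
    Comp (Option (Assignment n)) := do
  let s ← op (2 * m * m + 2) (⟨1, 0, 0, []⟩ : State m n)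
  loop O B p η ε cv T s

/-- The algorithm always terminates successfully, and `ρ` is the joint law of the assignment that it
returns and the resources that it uses. -/
def Returns {m n : ℕ} (O : Oracle m n) (B : Matrix (Fin m) (Fin n) ℝ) (p : Fin n → ℝ) (η ε : ℝ)
    (cv : Matrix (Fin m) (Fin m) ℝ → Comp (Matrix (Fin m) (Fin m) ℝ))
    (ρ : PMF (Assignment n × Cost)) : Prop :=
  ∃ T, (run O B p η ε cv T).law = ρ.map (fun r => (some r.1, r.2))

end MWU

end

/-! The proof is a potential argument with `tr W`, where `W = exp S`. The Golden–Thompson inequality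
`trace_exp_add_le`, together with `exp X ⪯ 1 + (1 + c) X` for `0 ⪯ X ⪯ c` and `c ≤ 1`, bounds the
growth of `tr W` in one round. Since `α_t ‖M_t‖ = ε / 6`, an exact covariance multiplies it by at
most `exp ((1 + ε/6) η α_t)`. The logarithm of `tr W` dominates the largest eigenvalue of `S = ∑ α_τ
M_τ`, and `tr W` starts at `m`. So at exit, where `2 ln m ≤ ε η α`, the weighted average of the
`M_τ` is at most `(1 + 2ε/3) η`.

Every feasible law has the same mean `2p - 1`. Hence the covariance of the output in a direction `v`
is the expectation of one fixed function of the returned assignment, and mixing laws mixes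
covariances. Given `W_{t-1}`, the sample `z_t` is independent of `M_t`, so samples may be replaced
by their conditional expectations; `ev_loop` turns the law of the result into the recursion `value`
over the matrices alone.

For estimated covariances, `value_le` carries the sum `d` of the Frobenius errors made so far. The
final bound is affine in `d` with slope 3, so only the mean error per round matters, and it has to
fit into the remaining slack `ε η / 3`. The mean error is controlled by the variance of a sum of
independent centred matrices (`ev_scatter_le`, `ev_empiricalCov_le`).

Termination holds on every run (`sat_loop`). With exact covariances `tr S` grows by at least `ε / 6`
per round but is bounded through `tr W`, independently of `η`. With empirical ones the deterministic
bound `tr M ≤ 4 n²` forces each `α_t` to be at least `ε / (24 n²)`. -/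

open Filter Topology

/-! ### The Lie product formula in a Banach algebra. -/

namespace NormedSpace

theorem norm_exp_le_exp_norm {𝔸 : Type*} [NormedRing 𝔸] [NormOneClass 𝔸] [NormedAlgebra ℝ 𝔸]
    (x : 𝔸) : ‖exp x‖ ≤ Real.exp ‖x‖ := by
  have hs := norm_expSeries_summable' (𝕂 := ℝ) x
  rw [exp_eq_tsum ℝ, Real.exp_eq_exp_ℝ, exp_eq_tsum ℝ]
  refine (norm_tsum_le_tsum_norm hs).trans ?_
  refine hs.tsum_le_tsum (fun n => ?_) (expSeries_summable' (𝕂 := ℝ) ‖x‖)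
  rw [norm_smul, smul_eq_mul, Real.norm_of_nonneg (by positivity)]
  gcongr
  exact norm_pow_le x n

/-- Telescoping gives `n` summands, each with `n - 1` factors of norm at most `K`; the condition `1
≤ K` allows the convenient exponent `n`. -/
theorem norm_pow_sub_pow_le {𝔸 : Type*} [NormedRing 𝔸] [NormOneClass 𝔸] {X Y : 𝔸} {K : ℝ}
    (hK : 1 ≤ K) (hX : ‖X‖ ≤ K) (hY : ‖Y‖ ≤ K) (n : ℕ) :
    ‖X ^ n - Y ^ n‖ ≤ n * ‖X - Y‖ * K ^ n := by
  induction n with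
  | zero => simp
  | succ n ih =>
    have e : X ^ (n + 1) - Y ^ (n + 1) = X * (X ^ n - Y ^ n) + (X - Y) * Y ^ n := by
      rw [pow_succ', pow_succ']; noncomm_ring
    have h1 : ‖X * (X ^ n - Y ^ n)‖ ≤ K * (n * ‖X - Y‖ * K ^ n) :=
      (norm_mul_le _ _).trans (mul_le_mul hX ih (norm_nonneg _) (by linarith))
    have h2 : ‖(X - Y) * Y ^ n‖ ≤ ‖X - Y‖ * K ^ (n + 1) := by
      refine (norm_mul_le _ _).trans (mul_le_mul_of_nonneg_left ?_ (norm_nonneg _))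
      refine (norm_pow_le _ _).trans ((pow_le_pow_left₀ (norm_nonneg _) hY n).trans ?_)
      exact pow_le_pow_right₀ hK (by omega)
    rw [e]
    refine (norm_add_le _ _).trans ((add_le_add h1 h2).trans (le_of_eq ?_))
    push_cast; ring

/-- The **Lie product formula**. -/
theorem tendsto_exp_mul_exp_pow {𝔸 : Type*} [NormedRing 𝔸] [NormOneClass 𝔸] [NormedAlgebra ℝ 𝔸]
    [CompleteSpace 𝔸] (A B : 𝔸) :
    Tendsto (fun n : ℕ => (exp ((n : ℝ)⁻¹ • A) * exp ((n : ℝ)⁻¹ • B)) ^ n) atTop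
      (𝓝 (exp (A + B))) := by
  -- Both terms have derivative `A + B` at `0`, so `n ‖h (1/n)‖` is a difference quotient tending to
  -- `0`. This is the factor `n ‖X - Y‖` of the telescoping bound, while `K ^ n` stays equal to `exp
  -- (‖A‖ + ‖B‖)`.
  let h : ℝ → 𝔸 := fun t => exp (t • A) * exp (t • B) - exp (t • (A + B))
  have hd : HasDerivAt h 0 0 := by
    have := ((hasDerivAt_exp_smul_const (𝕂 := ℝ) A 0).mul
      (hasDerivAt_exp_smul_const (𝕂 := ℝ) B 0)).sub (hasDerivAt_exp_smul_const (𝕂 := ℝ) (A + B) 0)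
    exact this.congr_deriv (by simp)
  have h0 : h 0 = 0 := by simp [h]
  have hinv : Tendsto (fun n : ℕ => (n : ℝ)⁻¹) atTop (𝓝[≠] 0) :=
    tendsto_nhdsWithin_iff.2 ⟨tendsto_inv_atTop_nhds_zero_nat, by
      filter_upwards [eventually_gt_atTop 0] with n hn
      simpa using hn.ne'⟩
  have hl : Tendsto (fun n : ℕ => (n : ℝ) * ‖h (n : ℝ)⁻¹‖) atTop (𝓝 0) := by
    have := (hd.tendsto_slope.comp hinv).norm
    simp only [norm_zero] at this
    refine this.congr fun n => ?_
    simp [slope, h0, norm_smul]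
  have hl2 := hl.mul_const (Real.exp (‖A‖ + ‖B‖))
  rw [zero_mul] at hl2
  rw [tendsto_iff_norm_sub_tendsto_zero]
  refine squeeze_zero' (Eventually.of_forall fun _ => norm_nonneg _) ?_ hl2
  filter_upwards [eventually_gt_atTop 0] with n hn
  have hn' : (n : ℝ) ≠ 0 := by exact_mod_cast hn.ne'
  have hi : (0 : ℝ) ≤ (n : ℝ)⁻¹ := by positivity
  have hpow : exp (A + B) = exp ((n : ℝ)⁻¹ • (A + B)) ^ n := by
    let _ : NormedAlgebra ℚ 𝔸 := NormedAlgebra.restrictScalars ℚ ℝ 𝔸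
    rw [← exp_nsmul, ← Nat.cast_smul_eq_nsmul ℝ, smul_smul, mul_inv_cancel₀ hn', one_smul]
  have hK : Real.exp ((n : ℝ)⁻¹ * (‖A‖ + ‖B‖)) ^ n = Real.exp (‖A‖ + ‖B‖) := by
    rw [← Real.exp_nat_mul, ← mul_assoc, mul_inv_cancel₀ hn', one_mul]
  rw [hpow, ← hK]
  refine norm_pow_sub_pow_le (Real.one_le_exp (by positivity)) ?_ ?_ n
  · refine (norm_mul_le _ _).trans ?_
    rw [mul_add, Real.exp_add]
    refine mul_le_mul ?_ ?_ (norm_nonneg _) (Real.exp_nonneg _) <;>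
    · refine (norm_exp_le_exp_norm _).trans (le_of_eq ?_)
      rw [norm_smul, Real.norm_of_nonneg hi]
  · refine (norm_exp_le_exp_norm _).trans ?_
    rw [norm_smul, Real.norm_of_nonneg hi]
    gcongr
    exact norm_add_le _ _

end NormedSpace

/-! ### Trace inequalities for powers, and Golden–Thompson. -/

namespace Matrix

variable {ι : Type*} [Fintype ι]

theorem trace_mul_pow_comm [DecidableEq ι] (P Q : Matrix ι ι ℝ) (k : ℕ) :
    ((P * Q) ^ k).trace = ((Q * P) ^ k).trace := by
  cases k with
  | zero => simp
  | succ k =>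
    have : P * (Q * P) ^ k = (P * Q) ^ k * P := by
      induction k with
      | zero => simp
      | succ k ih => rw [pow_succ, ← mul_assoc, ih, pow_succ]; simp only [mul_assoc]
    rw [pow_succ, ← mul_assoc, ← this, trace_mul_comm, ← mul_assoc, ← pow_succ']

theorem trace_mul_self_transpose_nonneg (A : Matrix ι ι ℝ) : 0 ≤ (A * Aᵀ).trace := by
  simp only [trace, diag_apply, mul_apply, transpose_apply]
  exact Finset.sum_nonneg fun i _ => Finset.sum_nonneg fun j _ => mul_self_nonneg _

theorem two_mul_trace_mul_le (A B : Matrix ι ι ℝ) :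
    2 * (A * B).trace ≤ (A * Aᵀ).trace + (B * Bᵀ).trace := by
  have h := trace_mul_self_transpose_nonneg (A - Bᵀ)
  have e1 : (Bᵀ * Aᵀ).trace = (A * B).trace := by
    rw [← transpose_mul, trace_transpose]
  have e2 : (Bᵀ * B).trace = (B * Bᵀ).trace := trace_mul_comm _ _
  simp only [transpose_sub, transpose_transpose, sub_mul, mul_sub, trace_sub] at h
  linarith

/-- The two statements feed each other. The first at `j + 1` follows by applying both at `j`, to
`Z²` and to the pair `Z Zᵀ`, `Zᵀ Z`, and finishing with the inequality of means for traces. The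
second at `j + 1` uses the first for `X Y`, rewrites `X Y Y X` cyclically as `X² Y²`, and applies
the second at `j`. -/
theorem trace_pow_two_pow_le [DecidableEq ι] (j : ℕ) :
    (∀ Z : Matrix ι ι ℝ, (Z ^ 2 ^ (j + 1)).trace ≤ ((Z * Zᵀ) ^ 2 ^ j).trace) ∧
    (∀ X Y : Matrix ι ι ℝ, X.IsSymm → Y.IsSymm →
      ((X * Y) ^ 2 ^ j).trace ≤ (X ^ 2 ^ j * Y ^ 2 ^ j).trace) := by
  induction j with
  | zero =>
    refine ⟨fun Z => ?_, fun X Y _ _ => by simp⟩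
    have := two_mul_trace_mul_le Z Z
    simp only [zero_add, pow_one, pow_zero, pow_two]
    linarith
  | succ j ih =>
    obtain ⟨hA, hB⟩ := ih
    refine ⟨fun Z => ?_, fun X Y hX hY => ?_⟩
    · have e1 : Z ^ 2 ^ (j + 1 + 1) = (Z ^ 2) ^ 2 ^ (j + 1) := by
        rw [← pow_mul, ← pow_succ']
      have e2 : (((Z ^ 2) * (Z ^ 2)ᵀ) ^ 2 ^ j).trace
          = (((Z * Zᵀ) * (Zᵀ * Z)) ^ 2 ^ j).trace := by
        rw [pow_two, transpose_mul, mul_assoc Z Z, trace_mul_pow_comm Z]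
        simp only [mul_assoc]
      have hs1 : (Z * Zᵀ).IsSymm := by simp [IsSymm, transpose_mul]
      have hs2 : (Zᵀ * Z).IsSymm := by simp [IsSymm, transpose_mul]
      have h1 := hB _ _ hs1 hs2
      have h2 := two_mul_trace_mul_le ((Z * Zᵀ) ^ 2 ^ j) ((Zᵀ * Z) ^ 2 ^ j)
      rw [transpose_pow, transpose_pow, hs1, hs2, ← pow_add, ← pow_add, ← two_mul, ← pow_succ',
        trace_mul_pow_comm Zᵀ] at h2
      rw [e1]
      have h3 := hA (Z ^ 2)
      rw [e2] at h3
      linarith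
    · have h1 := hA (X * Y)
      have e : (((X * Y) * (X * Y)ᵀ) ^ 2 ^ j).trace = (((X ^ 2) * (Y ^ 2)) ^ 2 ^ j).trace := by
        rw [transpose_mul, hX, hY, ← mul_assoc, trace_mul_pow_comm _ X]
        simp only [pow_two, mul_assoc]
      have h2 := hB (X ^ 2) (Y ^ 2) (by rw [IsSymm, transpose_pow, hX])
        (by rw [IsSymm, transpose_pow, hY])
      rw [e] at h1
      rw [← pow_mul, ← pow_mul, ← pow_succ'] at h2
      exact h1.trans h2

section

attribute [local instance] Matrix.linftyOpNormedRing Matrix.linftyOpNormedAlgebra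

/-- The **Golden–Thompson inequality** for real symmetric matrices. -/
theorem trace_exp_add_le [DecidableEq ι] {A B : Matrix ι ι ℝ} (hA : A.IsSymm) (hB : B.IsSymm) :
    (NormedSpace.exp (A + B)).trace ≤ (NormedSpace.exp A * NormedSpace.exp B).trace := by
  -- The auxiliary norm satisfies `‖1‖ = 1` only for a nonempty index type.
  rcases isEmpty_or_nonempty ι with hι | hι
  · simp [trace]
  -- The limit is taken along powers of two, the only exponents for which the trace inequality is
  -- available.
  have ht : Tendsto (fun k : ℕ => 2 ^ k) atTop atTop := tendsto_pow_atTop_atTop_of_one_lt one_lt_two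
  have hlim := ((continuous_id.matrix_trace (n := ι) (R := ℝ)).tendsto _).comp
    ((NormedSpace.tendsto_exp_mul_exp_pow A B).comp ht)
  refine le_of_tendsto hlim (Eventually.of_forall fun k => ?_)
  have hk : ((2 ^ k : ℕ) : ℝ) ≠ 0 := by positivity
  have hpow : ∀ C : Matrix ι ι ℝ,
      NormedSpace.exp ((((2 ^ k : ℕ) : ℝ))⁻¹ • C) ^ 2 ^ k = NormedSpace.exp C := fun C => by
    rw [← Matrix.exp_nsmul, ← Nat.cast_smul_eq_nsmul ℝ, smul_smul, mul_inv_cancel₀ hk, one_smul]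
  have := (trace_pow_two_pow_le k).2 (NormedSpace.exp ((((2 ^ k : ℕ) : ℝ))⁻¹ • A))
    (NormedSpace.exp ((((2 ^ k : ℕ) : ℝ))⁻¹ • B)) (hA.smul _).exp (hB.smul _).exp
  rw [hpow, hpow] at this
  exact this

end

end Matrix

/-! ### Diagonalization, the Loewner order and the multiplicative weights step. -/

namespace Matrix

set_option linter.unusedSectionVars false

variable {ι : Type*} [Fintype ι] [DecidableEq ι]

theorem IsSymm.exists_eq_conj_diagonal {A : Matrix ι ι ℝ} (hA : A.IsSymm) :
    ∃ (U : Matrix ι ι ℝ) (d : ι → ℝ), U * Uᵀ = 1 ∧ Uᵀ * U = 1 ∧ A = U * diagonal d * Uᵀ := by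
  have hH : A.IsHermitian := by rw [IsHermitian, conjTranspose_eq_transpose_of_trivial]; exact hA
  refine ⟨hH.eigenvectorUnitary, hH.eigenvalues, ?_, ?_, ?_⟩
  · have := Unitary.coe_mul_star_self hH.eigenvectorUnitary
    rwa [Unitary.coe_star, star_eq_conjTranspose, conjTranspose_eq_transpose_of_trivial] at this
  · have := Unitary.coe_star_mul_self hH.eigenvectorUnitary
    rwa [star_eq_conjTranspose, conjTranspose_eq_transpose_of_trivial] at this
  · have := hH.spectral_theorem
    rw [Unitary.conjStarAlgAut_apply] at this
    rw [star_eq_conjTranspose, conjTranspose_eq_transpose_of_trivial] at this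
    simpa [Function.comp_def] using this

theorem exp_conj_diagonal {U : Matrix ι ι ℝ} (d : ι → ℝ) (h₁ : U * Uᵀ = 1) (h₂ : Uᵀ * U = 1) :
    NormedSpace.exp (U * diagonal d * Uᵀ) = U * diagonal (fun i => Real.exp (d i)) * Uᵀ := by
  have h := Matrix.exp_units_conj ⟨U, Uᵀ, h₁, h₂⟩ (diagonal d)
  rw [Matrix.exp_diagonal] at h
  refine h.trans ?_
  congr 3
  funext i
  rw [Pi.coe_exp, Real.exp_eq_exp_ℝ]

theorem posSemidef_conj_diagonal (U : Matrix ι ι ℝ) {d : ι → ℝ} (hd : ∀ i, 0 ≤ d i) :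
    (U * diagonal d * Uᵀ).PosSemidef := by
  have := (PosSemidef.diagonal (n := ι) (R := ℝ) (d := d) hd).mul_mul_conjTranspose_same U
  rwa [conjTranspose_eq_transpose_of_trivial] at this

theorem nonneg_of_posSemidef_conj_diagonal {U : Matrix ι ι ℝ} {d : ι → ℝ} (h₂ : Uᵀ * U = 1)
    (h : (U * diagonal d * Uᵀ).PosSemidef) (i : ι) : 0 ≤ d i := by
  have := h.conjTranspose_mul_mul_same U
  have e : Uᴴ * (U * diagonal d * Uᵀ) * U = diagonal d := by
    rw [conjTranspose_eq_transpose_of_trivial]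
    calc Uᵀ * (U * diagonal d * Uᵀ) * U = (Uᵀ * U) * diagonal d * (Uᵀ * U) := by
          simp only [mul_assoc]
      _ = diagonal d := by rw [h₂, one_mul, mul_one]
  rw [e] at this
  exact posSemidef_diagonal_iff.1 this i

theorem trace_conj_transpose {U : Matrix ι ι ℝ} (D : Matrix ι ι ℝ) (h₂ : Uᵀ * U = 1) :
    (U * D * Uᵀ).trace = D.trace := by
  rw [trace_mul_comm, ← mul_assoc, h₂, one_mul]

theorem smul_one_eq_conj {U : Matrix ι ι ℝ} (h₁ : U * Uᵀ = 1) (c : ℝ) :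
    c • (1 : Matrix ι ι ℝ) = U * diagonal (fun _ => c) * Uᵀ := by
  rw [show (diagonal fun _ : ι => c) = c • (1 : Matrix ι ι ℝ) from (smul_one_eq_diagonal c).symm]
  rw [Matrix.mul_smul, Matrix.mul_one, Matrix.smul_mul, h₁]

theorem conj_sub_conj (U D E : Matrix ι ι ℝ) :
    U * D * Uᵀ - U * E * Uᵀ = U * (D - E) * Uᵀ := by
  rw [mul_sub, sub_mul]

theorem PosSemidef.isSymm {A : Matrix ι ι ℝ} (hA : A.PosSemidef) : A.IsSymm := by
  have := hA.1
  rwa [IsHermitian, conjTranspose_eq_transpose_of_trivial] at this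

theorem IsSymm.posDef_exp {A : Matrix ι ι ℝ} (hA : A.IsSymm) : (NormedSpace.exp A).PosDef := by
  obtain ⟨U, d, h₁, h₂, rfl⟩ := hA.exists_eq_conj_diagonal
  rw [exp_conj_diagonal d h₁ h₂]
  have hp : (diagonal fun i => Real.exp (d i)).PosDef := PosDef.diagonal fun i => Real.exp_pos _
  have hU : IsUnit U := ⟨⟨U, Uᵀ, h₁, h₂⟩, rfl⟩
  have := (IsUnit.posDef_star_right_conjugate_iff (x := diagonal fun i => Real.exp (d i)) hU).2 hp
  rwa [star_eq_conjTranspose, conjTranspose_eq_transpose_of_trivial] at this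

theorem PosSemidef.trace_mul_nonneg {A B : Matrix ι ι ℝ} (hA : A.PosSemidef) (hB : B.PosSemidef) :
    0 ≤ (A * B).trace := by
  obtain ⟨U, d, h₁, h₂, rfl⟩ := hB.isSymm.exists_eq_conj_diagonal
  have hd := nonneg_of_posSemidef_conj_diagonal h₂ hB
  have hA' := hA.conjTranspose_mul_mul_same U
  rw [conjTranspose_eq_transpose_of_trivial] at hA'
  rw [← mul_assoc, trace_mul_comm, ← mul_assoc, ← mul_assoc]
  simp only [trace, diag_apply, mul_diagonal]
  exact Finset.sum_nonneg fun i _ => mul_nonneg hA'.diag_nonneg (hd i)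

theorem trace_mul_le_of_posSemidef_sub {A B W : Matrix ι ι ℝ} (h : (B - A).PosSemidef)
    (hW : W.PosSemidef) : (A * W).trace ≤ (B * W).trace := by
  have := h.trace_mul_nonneg hW
  rw [sub_mul, trace_sub] at this
  linarith

/-- On eigenvalues this is `exp x ≤ 1 + x + x² ≤ 1 + (1 + c) x` for `0 ≤ x ≤ c ≤ 1`. -/
theorem posSemidef_one_add_smul_sub_exp {A : Matrix ι ι ℝ} {c : ℝ} (hA : A.PosSemidef)
    (hc : (c • (1 : Matrix ι ι ℝ) - A).PosSemidef) (hc1 : c ≤ 1) :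
    ((1 : Matrix ι ι ℝ) + (1 + c) • A - NormedSpace.exp A).PosSemidef := by
  obtain ⟨U, d, h₁, h₂, rfl⟩ := hA.isSymm.exists_eq_conj_diagonal
  have hd := nonneg_of_posSemidef_conj_diagonal h₂ hA
  rw [smul_one_eq_conj h₁, conj_sub_conj, diagonal_sub] at hc
  have hd' := nonneg_of_posSemidef_conj_diagonal h₂ hc
  rw [exp_conj_diagonal d h₁ h₂, ← one_smul ℝ (1 : Matrix ι ι ℝ), smul_one_eq_conj h₁,
    ← Matrix.smul_mul, ← Matrix.mul_smul, ← add_mul, ← mul_add, conj_sub_conj, ← diagonal_smul, diagonal_add,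
    diagonal_sub]
  refine posSemidef_conj_diagonal U fun i => ?_
  have h0 := hd i
  have h1 := hd' i
  have h2 := abs_le.1 (Real.abs_exp_sub_one_sub_id_le (x := d i)
    (abs_le.2 ⟨by linarith, by linarith⟩))
  simp only [Pi.smul_apply, smul_eq_mul]
  nlinarith [h2.2]

/-- The exponential of each eigenvalue is one of the positive summands of the trace. This is how the
potential controls the largest eigenvalue. -/
theorem IsSymm.posSemidef_log_trace_exp_sub {A : Matrix ι ι ℝ} (hA : A.IsSymm) :
    (Real.log (NormedSpace.exp A).trace • (1 : Matrix ι ι ℝ) - A).PosSemidef := by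
  obtain ⟨U, d, h₁, h₂, rfl⟩ := hA.exists_eq_conj_diagonal
  rw [exp_conj_diagonal d h₁ h₂, trace_conj_transpose _ h₂, smul_one_eq_conj h₁, conj_sub_conj, diagonal_sub]
  refine posSemidef_conj_diagonal U fun i => sub_nonneg.2 ?_
  have : Real.exp (d i) ≤ (diagonal fun i => Real.exp (d i)).trace := by
    rw [trace_diagonal]
    exact Finset.single_le_sum (f := fun i => Real.exp (d i)) (fun _ _ => (Real.exp_pos _).le)
      (Finset.mem_univ i)
  exact (Real.le_log_iff_exp_le ((Real.exp_pos _).trans_le this)).2 this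

theorem PosSemidef.posSemidef_trace_smul_one_sub {A : Matrix ι ι ℝ} (hA : A.PosSemidef) :
    (A.trace • (1 : Matrix ι ι ℝ) - A).PosSemidef := by
  obtain ⟨U, d, h₁, h₂, rfl⟩ := hA.isSymm.exists_eq_conj_diagonal
  have hd := nonneg_of_posSemidef_conj_diagonal h₂ hA
  rw [trace_conj_transpose _ h₂, smul_one_eq_conj h₁, conj_sub_conj, diagonal_sub]
  refine posSemidef_conj_diagonal U fun i => sub_nonneg.2 ?_
  rw [trace_diagonal]
  exact Finset.single_le_sum (fun i _ => hd i) (Finset.mem_univ i)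

theorem dotProduct_mulVec_le_of_posSemidef_sub {A B : Matrix ι ι ℝ} (h : (B - A).PosSemidef)
    (v : ι → ℝ) : v ⬝ᵥ (A *ᵥ v) ≤ v ⬝ᵥ (B *ᵥ v) := by
  have := h.dotProduct_mulVec_nonneg v
  rw [star_trivial, sub_mulVec, dotProduct_sub] at this
  linarith

/-- One step of the matrix multiplicative weights update. -/
theorem trace_exp_add_smul_le {S M : Matrix ι ι ℝ} {a c h : ℝ} (hS : S.IsSymm) (hM : M.PosSemidef)
    (ha : 0 ≤ a) (hc : (c • (1 : Matrix ι ι ℝ) - a • M).PosSemidef) (hc0 : 0 ≤ c) (hc1 : c ≤ 1)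
    (hMW : (M * NormedSpace.exp S).trace ≤ h * (NormedSpace.exp S).trace) :
    (NormedSpace.exp (S + a • M)).trace ≤
      (NormedSpace.exp S).trace * Real.exp ((1 + c) * (h * a)) := by
  have hW := hS.posDef_exp.posSemidef
  have haM : (a • M).PosSemidef := hM.smul ha
  have h1 := trace_exp_add_le hS haM.isSymm
  rw [trace_mul_comm] at h1
  have h2 := trace_mul_le_of_posSemidef_sub (posSemidef_one_add_smul_sub_exp haM hc hc1) hW
  rw [add_mul, one_mul, trace_add, smul_smul, Matrix.smul_mul, trace_smul, smul_eq_mul] at h2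
  have h3 := mul_le_mul_of_nonneg_left hMW (show 0 ≤ (1 + c) * a by positivity)
  -- The factor `1 + (1 + c) h a` is relaxed to an exponential so that the bounds of successive
  -- rounds multiply.
  have h4 := mul_le_mul_of_nonneg_left (Real.add_one_le_exp ((1 + c) * (h * a))) hW.trace_nonneg
  linarith

/-- The Frobenius norm. -/
noncomputable def frob (A : Matrix ι ι ℝ) : ℝ := √(∑ i, ∑ j, A i j ^ 2)

theorem frob_nonneg (A : Matrix ι ι ℝ) : 0 ≤ A.frob := Real.sqrt_nonneg _

theorem frob_sq (A : Matrix ι ι ℝ) : A.frob ^ 2 = ∑ i, ∑ j, A i j ^ 2 :=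
  Real.sq_sqrt (Finset.sum_nonneg fun _ _ => Finset.sum_nonneg fun _ _ => sq_nonneg _)

theorem frob_neg (A : Matrix ι ι ℝ) : (-A).frob = A.frob := by simp [frob]

theorem frob_smul (c : ℝ) (A : Matrix ι ι ℝ) : (c • A).frob ^ 2 = c ^ 2 * A.frob ^ 2 := by
  simp [frob_sq, mul_pow, Finset.mul_sum]

theorem frob_zero : (0 : Matrix ι ι ℝ).frob = 0 := by simp [frob]

/-- Cauchy–Schwarz for the entries of `A` and of `v vᵀ`. The Frobenius norm serves as the error
measure because its square is additive for independent centred matrices. -/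
theorem dotProduct_mulVec_le_frob (A : Matrix ι ι ℝ) (v : ι → ℝ) :
    v ⬝ᵥ (A *ᵥ v) ≤ A.frob * (v ⬝ᵥ v) := by
  have hv : 0 ≤ v ⬝ᵥ v := Finset.sum_nonneg fun i _ => mul_self_nonneg _
  refine abs_le_of_sq_le_sq' ?_ (mul_nonneg A.frob_nonneg hv) |>.2
  have e1 : v ⬝ᵥ (A *ᵥ v) = ∑ x : ι × ι, A x.1 x.2 * (v x.1 * v x.2) := by
    simp only [dotProduct, mulVec, Finset.mul_sum, Fintype.sum_prod_type]
    exact Finset.sum_congr rfl fun i _ => Finset.sum_congr rfl fun j _ => by ring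
  have e2 : (v ⬝ᵥ v) ^ 2 = ∑ x : ι × ι, (v x.1 * v x.2) ^ 2 := by
    simp only [dotProduct, Fintype.sum_prod_type, pow_two, Finset.sum_mul_sum]
    exact Finset.sum_congr rfl fun i _ => Finset.sum_congr rfl fun j _ => by ring
  rw [mul_pow, frob_sq, e1, e2, ← Fintype.sum_prod_type' (fun i j => A i j ^ 2)]
  exact Finset.sum_mul_sq_le_sq_mul_sq _ _ _

theorem posSemidef_smul_one_sub_of_le {A : Matrix ι ι ℝ} {c : ℝ} (hA : A.IsSymm)
    (h : ∀ v, v ⬝ᵥ (A *ᵥ v) ≤ c * (v ⬝ᵥ v)) : (c • (1 : Matrix ι ι ℝ) - A).PosSemidef := by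
  refine PosSemidef.of_dotProduct_mulVec_nonneg ?_ fun v => ?_
  · rw [IsHermitian, conjTranspose_eq_transpose_of_trivial, transpose_sub, hA, transpose_smul,
      transpose_one]
  · rw [star_trivial, sub_mulVec, dotProduct_sub, smul_mulVec, one_mulVec, dotProduct_smul,
      smul_eq_mul]
    linarith [h v]

theorem IsSymm.posSemidef_frob_sub {A : Matrix ι ι ℝ} (hA : A.IsSymm) :
    (A.frob • (1 : Matrix ι ι ℝ) - A).PosSemidef :=
  posSemidef_smul_one_sub_of_le hA A.dotProduct_mulVec_le_frob

end Matrix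

/-! ### The operator norm and the Loewner order. -/

namespace MWU

open Matrix

theorem opNorm_nonneg {m : ℕ} (A : Matrix (Fin m) (Fin m) ℝ) : 0 ≤ opNorm A := norm_nonneg _

theorem opNorm_eq_zero {m : ℕ} {A : Matrix (Fin m) (Fin m) ℝ} : opNorm A = 0 ↔ A = 0 := by
  rw [opNorm, norm_eq_zero]
  exact map_eq_zero_iff _ (Matrix.toEuclideanCLM (n := Fin m) (𝕜 := ℝ)).injective

theorem posSemidef_opNorm_sub {m : ℕ} {A : Matrix (Fin m) (Fin m) ℝ} (hA : A.IsSymm) :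
    (opNorm A • (1 : Matrix (Fin m) (Fin m) ℝ) - A).PosSemidef := by
  refine posSemidef_smul_one_sub_of_le hA fun v => ?_
  set x : EuclideanSpace ℝ (Fin m) := WithLp.toLp 2 v
  have h1 : inner ℝ x (Matrix.toEuclideanCLM (n := Fin m) (𝕜 := ℝ) A x) = v ⬝ᵥ (A *ᵥ v) := by
    rw [dotProduct_comm]; simp [x, EuclideanSpace.inner_eq_star_dotProduct]
  have h2 : ‖x‖ * ‖x‖ = v ⬝ᵥ v := by
    rw [← pow_two, EuclideanSpace.real_norm_sq_eq]; simp [x, dotProduct, pow_two]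
  rw [← h1, ← h2]
  refine (real_inner_le_norm _ _).trans ?_
  have := mul_le_mul_of_nonneg_left
    ((Matrix.toEuclideanCLM (n := Fin m) (𝕜 := ℝ) A).le_opNorm x) (norm_nonneg x)
  rw [opNorm]
  linarith

/-- In an orthonormal eigenbasis both order bounds say that the eigenvalues lie in `[0, c]`, and
orthogonal changes of basis preserve lengths. -/
theorem opNorm_le_of_posSemidef {m : ℕ} {A : Matrix (Fin m) (Fin m) ℝ} {c : ℝ} (hc : 0 ≤ c)
    (hA : A.PosSemidef) (h : (c • (1 : Matrix (Fin m) (Fin m) ℝ) - A).PosSemidef) :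
    opNorm A ≤ c := by
  obtain ⟨U, d, h₁, h₂, rfl⟩ := hA.isSymm.exists_eq_conj_diagonal
  have hd := nonneg_of_posSemidef_conj_diagonal h₂ hA
  rw [smul_one_eq_conj h₁, conj_sub_conj, diagonal_sub] at h
  have hd' := nonneg_of_posSemidef_conj_diagonal h₂ h
  refine ContinuousLinearMap.opNorm_le_bound _ hc fun x => ?_
  have key : ∀ (V : Matrix (Fin m) (Fin m) ℝ), Vᵀ * V = 1 → ∀ v, (V *ᵥ v) ⬝ᵥ (V *ᵥ v) = v ⬝ᵥ v := by
    intro V hV v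
    rw [dotProduct_mulVec, vecMul_mulVec, hV, vecMul_one]
  have hn : ∀ y : EuclideanSpace ℝ (Fin m), ‖y‖ ^ 2 = WithLp.ofLp y ⬝ᵥ WithLp.ofLp y := fun y => by
    rw [EuclideanSpace.real_norm_sq_eq]; simp [dotProduct, pow_two]
  refine abs_le_of_sq_le_sq' ?_ (by positivity) |>.2
  rw [mul_pow, hn, hn]
  set v := WithLp.ofLp x
  have e : WithLp.ofLp (Matrix.toEuclideanCLM (n := Fin m) (𝕜 := ℝ) (U * diagonal d * Uᵀ) x)
      = U *ᵥ (diagonal d *ᵥ (Uᵀ *ᵥ v)) := by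
    rw [mulVec_mulVec, mulVec_mulVec]; rfl
  rw [e, key U h₂, ← key Uᵀ (by rwa [transpose_transpose]) v]
  simp only [dotProduct, Finset.mul_sum]
  refine Finset.sum_le_sum fun i _ => ?_
  rw [mulVec_diagonal]
  have h0 := hd i
  have h1 := hd' i
  have : d i ^ 2 ≤ c ^ 2 := pow_le_pow_left₀ h0 (by linarith) 2
  nlinarith [mul_self_nonneg ((Uᵀ *ᵥ v) i)]

theorem opNorm_le_trace {m : ℕ} {A : Matrix (Fin m) (Fin m) ℝ} (hA : A.PosSemidef) :
    opNorm A ≤ A.trace :=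
  opNorm_le_of_posSemidef hA.trace_nonneg hA hA.posSemidef_trace_smul_one_sub

end MWU

noncomputable section

namespace MWU

open scoped ENNReal

/-! ## Expectations and supports of randomized computations -/

theorem tsum_bind_mul {α β : Type} (μ : PMF α) (f : α → PMF β) (g : β → ℝ≥0∞) :
    ∑' b, μ.bind f b * g b = ∑' a, μ a * ∑' b, f a b * g b := by
  simp only [PMF.bind_apply, ← ENNReal.tsum_mul_right, ← ENNReal.tsum_mul_left]
  rw [ENNReal.tsum_comm]
  simp only [mul_assoc]

theorem tsum_pure_mul {α : Type} (a : α) (g : α → ℝ≥0∞) : ∑' b, PMF.pure a b * g b = g a := by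
  rw [tsum_eq_single a]
  · simp
  · intro b hb; simp [PMF.pure_apply, hb]

theorem tsum_map_mul {α β : Type} (μ : PMF α) (f : α → β) (g : β → ℝ≥0∞) :
    ∑' b, μ.map f b * g b = ∑' a, μ a * g (f a) := by
  rw [← PMF.bind_pure_comp, tsum_bind_mul]
  simp only [Function.comp_apply, tsum_pure_mul]

theorem sum_pmf_eq_one {α : Type} [Fintype α] (μ : PMF α) : ∑ z, μ z = 1 :=
  (tsum_fintype _).symm.trans μ.tsum_coe

/-- The expectation of a function of the result of a computation. -/
def Comp.ev {α : Type} (c : Comp α) (g : α → ℝ≥0∞) : ℝ≥0∞ := ∑' r, c.law r * g r.1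

/-- Every possible result, with the resources used for it, satisfies `P`. -/
def Comp.Sat {α : Type} (c : Comp α) (P : α → Cost → Prop) : Prop :=
  ∀ r ∈ c.law.support, P r.1 r.2

namespace Comp

variable {α β : Type}

theorem law_bind (x : Comp α) (f : α → Comp β) :
    (x >>= f).law = x.law.bind fun r => (f r.1).law.map fun q => (q.1, Cost.add r.2 q.2) := rfl

theorem ev_bind (x : Comp α) (f : α → Comp β) (g : β → ℝ≥0∞) :
    (x >>= f).ev g = x.ev fun a => (f a).ev g := by
  simp only [ev, law_bind, tsum_bind_mul, tsum_map_mul]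

theorem ev_pure (a : α) (g : α → ℝ≥0∞) : (pure a : Comp α).ev g = g a := tsum_pure_mul _ _

theorem ev_op (k : ℕ) (a : α) (g : α → ℝ≥0∞) : (op k a).ev g = g a := tsum_pure_mul _ _

theorem ev_spectralOp (a : α) (g : α → ℝ≥0∞) : (spectralOp a).ev g = g a := tsum_pure_mul _ _

theorem ev_query {m n : ℕ} (O : Oracle m n) (B : Matrix (Fin m) (Fin n) ℝ)
    (W : Matrix (Fin m) (Fin m) ℝ) (p : Fin n → ℝ) (g : Assignment n → ℝ≥0∞) :
    (query O B W p).ev g = ∑ z, O B W p z * g z := by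
  simp only [ev, query, tsum_map_mul, tsum_fintype]

theorem ev_add (c : Comp α) (f g : α → ℝ≥0∞) : c.ev (fun a => f a + g a) = c.ev f + c.ev g := by
  simp only [ev, mul_add, ENNReal.tsum_add]

theorem ev_const_mul (c : Comp α) (k : ℝ≥0∞) (f : α → ℝ≥0∞) :
    c.ev (fun a => k * f a) = k * c.ev f := by
  simp only [ev, mul_left_comm _ k, ENNReal.tsum_mul_left]

theorem ev_const (c : Comp α) (k : ℝ≥0∞) : c.ev (fun _ => k) = k := by
  simp only [ev, ENNReal.tsum_mul_right, PMF.tsum_coe, one_mul]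

theorem ev_sum {ι : Type} (s : Finset ι) (c : Comp α) (f : ι → α → ℝ≥0∞) :
    c.ev (fun a => ∑ i ∈ s, f i a) = ∑ i ∈ s, c.ev (f i) := by
  classical
  induction s using Finset.induction_on with
  | empty => simp [ev]
  | insert i s hi ih => simp only [Finset.sum_insert hi, ev_add, ih]

theorem Sat.ev_mono {c : Comp α} {P : α → Cost → Prop} (hc : c.Sat P) {f g : α → ℝ≥0∞}
    (h : ∀ a k, P a k → f a ≤ g a) : c.ev f ≤ c.ev g := by
  refine ENNReal.tsum_le_tsum fun r => ?_
  by_cases hr : r ∈ c.law.support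
  · gcongr
    exact h _ _ (hc r hr)
  · simp [(PMF.apply_eq_zero_iff _ _).2 hr]

theorem Sat.mono {c : Comp α} {P Q : α → Cost → Prop} (hc : c.Sat P) (h : ∀ a k, P a k → Q a k) :
    c.Sat Q := fun r hr => h _ _ (hc r hr)

theorem Sat.bind {x : Comp α} {f : α → Comp β} {P : α → Cost → Prop} {Q : β → Cost → Prop}
    (hx : x.Sat P) (hf : ∀ a c, P a c → (f a).Sat fun b d => Q b (c.add d)) : (x >>= f).Sat Q := by
  intro r hr
  rw [law_bind, PMF.mem_support_bind_iff] at hr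
  obtain ⟨a, ha, hr⟩ := hr
  rw [PMF.mem_support_map_iff] at hr
  obtain ⟨q, hq, rfl⟩ := hr
  exact hf _ _ (hx a ha) q hq

theorem sat_pure {a : α} {P : α → Cost → Prop} (h : P a ⟨0, 0, 0⟩) : (pure a : Comp α).Sat P := by
  intro r hr
  obtain rfl := (PMF.mem_support_pure_iff _ _).1 hr
  exact h

theorem sat_op {k : ℕ} {a : α} {P : α → Cost → Prop} (h : P a ⟨0, k, 0⟩) : (op k a).Sat P := by
  intro r hr
  obtain rfl := (PMF.mem_support_pure_iff _ _).1 hr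
  exact h

theorem sat_spectralOp {a : α} {P : α → Cost → Prop} (h : P a ⟨0, 0, 1⟩) :
    (spectralOp a).Sat P := by
  intro r hr
  obtain rfl := (PMF.mem_support_pure_iff _ _).1 hr
  exact h

theorem sat_query {m n : ℕ} {O : Oracle m n} {B : Matrix (Fin m) (Fin n) ℝ}
    {W : Matrix (Fin m) (Fin m) ℝ} {p : Fin n → ℝ} {P : Assignment n → Cost → Prop}
    (h : ∀ z, P z ⟨1, m * n + m * m + 2 * n + 1, 0⟩) : (query O B W p).Sat P := by
  intro r hr
  obtain ⟨z, -, rfl⟩ := (PMF.mem_support_map_iff _ _ _).1 hr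
  exact h z

end Comp

/-! ## The result of the algorithm, with the samples averaged out -/

variable {m n : ℕ}

/-- The history records nonnegative weights with sum `α`. -/
def HistOK (s : State m n) : Prop :=
  (∀ e ∈ s.hist, 0 ≤ e.1) ∧ (s.hist.map Prod.fst).sum = s.α

theorem HistOK.cons {s : State m n} (h : HistOK s) {a : ℝ} (ha : 0 ≤ a) (z : Assignment n)
    (W S : Matrix (Fin m) (Fin m) ℝ) : HistOK ⟨W, S, s.α + a, (a, z) :: s.hist⟩ := by
  refine ⟨fun e he => ?_, ?_⟩
  · rcases List.mem_cons.1 he with rfl | he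
    · exact ha
    · exact h.1 e he
  · simp [h.2, add_comm]

theorem HistOK.sum_eq_one {s : State m n} (h : HistOK s) (hα : 0 < s.α) :
    ∑ τ : Fin s.hist.length, ENNReal.ofReal ((s.hist.get τ).1 / s.α) = 1 := by
  rw [← ENNReal.ofReal_sum_of_nonneg]
  · rw [← Finset.sum_div]
    have : ∑ τ : Fin s.hist.length, (s.hist.get τ).1 = s.α := by
      rw [← h.2, ← Fin.sum_univ_fun_getElem]; rfl
    rw [this, div_self hα.ne', ENNReal.ofReal_one]
  · intro τ _
    exact div_nonneg (h.1 _ (List.get_mem _ _)) hα.le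

/-- The weighted sum of the values of `φ` over a history. -/
def histSum (φ : Assignment n → ℝ≥0∞) (h : List (ℝ × Assignment n)) : ℝ≥0∞ :=
  (h.map fun e => ENNReal.ofReal e.1 * φ e.2).sum

theorem ev_draw {s : State m n} (h : HistOK s) (hα : 0 < s.α) (φ : Assignment n → ℝ≥0∞) :
    (draw s.α s.hist).ev (fun o => o.elim 0 φ) = histSum φ s.hist / ENNReal.ofReal s.α := by
  have hw := h.sum_eq_one hα
  rw [draw, dif_pos hw]
  simp only [Comp.ev, tsum_map_mul, tsum_fintype, PMF.ofFintype_apply, Option.elim_some]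
  rw [histSum, ← Fin.sum_univ_fun_getElem, div_eq_mul_inv, Finset.sum_mul]
  refine Finset.sum_congr rfl fun τ _ => ?_
  rw [ENNReal.ofReal_div_of_pos hα, div_eq_mul_inv, mul_right_comm]
  rfl

theorem sat_draw {s : State m n} (h : HistOK s) (hα : 0 < s.α) :
    (draw s.α s.hist).Sat fun o c => o.isSome ∧ c = ⟨0, 2 * s.hist.length + 1, 0⟩ := by
  have hw := h.sum_eq_one hα
  rw [draw, dif_pos hw]
  intro r hr
  obtain ⟨z, -, rfl⟩ := (PMF.mem_support_map_iff _ _ _).1 hr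
  simp

/-- The expectation of `φ` at the result of the loop, when the sum of the values of `φ` over the
history is `x` and future samples are replaced by their conditional expectations. -/
def value (O : Oracle m n) (B : Matrix (Fin m) (Fin n) ℝ) (p : Fin n → ℝ) (η ε : ℝ)
    (cv : Matrix (Fin m) (Fin m) ℝ → Comp (Matrix (Fin m) (Fin m) ℝ)) (φ : Assignment n → ℝ≥0∞) :
    ℕ → Matrix (Fin m) (Fin m) ℝ → Matrix (Fin m) (Fin m) ℝ → ℝ → ℝ≥0∞ → ℝ≥0∞
  | 0, _, _, _, _ => 0
  | T + 1, W, S, α, x =>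
    open Classical in
    if α < 2 * Real.log m / (ε * η) then
      (cv W).ev fun M =>
        if opNorm M = 0 then ∑ z, O B W p z * φ z
        else value O B p η ε cv φ T (NormedSpace.exp (S + (ε / (6 * opNorm M)) • M))
          (S + (ε / (6 * opNorm M)) • M) (α + ε / (6 * opNorm M))
          (x + ENNReal.ofReal (ε / (6 * opNorm M)) * ∑ z, O B W p z * φ z)
    else x / ENNReal.ofReal α

/-- The accumulated sum never influences the control flow and enters the result affinely, so
averaging commutes with the recursion. -/
theorem value_sum (O : Oracle m n) (B : Matrix (Fin m) (Fin n) ℝ) (p : Fin n → ℝ) (η ε : ℝ)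
    (cv : Matrix (Fin m) (Fin m) ℝ → Comp (Matrix (Fin m) (Fin m) ℝ)) (φ : Assignment n → ℝ≥0∞)
    (μ : PMF (Assignment n)) (T : ℕ) :
    ∀ (W S : Matrix (Fin m) (Fin m) ℝ) (α : ℝ) (X : Assignment n → ℝ≥0∞),
      value O B p η ε cv φ T W S α (∑ z, μ z * X z)
        = ∑ z, μ z * value O B p η ε cv φ T W S α (X z) := by
  have h1 : ∑ z, μ z = 1 := sum_pmf_eq_one μ
  induction T with
  | zero => intro W S α X; simp [value]
  | succ T ih =>
    intro W S α X
    simp only [value]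
    split_ifs with h
    · simp only [← Comp.ev_const_mul]
      rw [← Comp.ev_sum]
      congr 1
      funext M
      split_ifs with hM
      · rw [← Finset.sum_mul, h1, one_mul]
      · rw [← ih]
        congr 1
        simp only [mul_add, Finset.sum_add_distrib]
        rw [← Finset.sum_mul, h1, one_mul]
    · simp only [div_eq_mul_inv, Finset.sum_mul, mul_assoc]

theorem ev_iteration (O : Oracle m n) (B : Matrix (Fin m) (Fin n) ℝ) (p : Fin n → ℝ) (ε : ℝ)
    (cv : Matrix (Fin m) (Fin m) ℝ → Comp (Matrix (Fin m) (Fin m) ℝ)) (s : State m n)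
    (g : State m n ⊕ Assignment n → ℝ≥0∞) :
    (iteration O B p ε cv s).ev g = ∑ z, O B s.W p z * (cv s.W).ev fun M =>
      open Classical in
      if opNorm M = 0 then g (Sum.inr z)
      else g (Sum.inl ⟨NormedSpace.exp (s.S + (ε / (6 * opNorm M)) • M),
        s.S + (ε / (6 * opNorm M)) • M, s.α + ε / (6 * opNorm M),
        (ε / (6 * opNorm M), z) :: s.hist⟩) := by
  simp only [iteration, Comp.ev_bind, Comp.ev_query, Comp.ev_spectralOp]
  refine Finset.sum_congr rfl fun z _ => ?_
  congr 2
  funext M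
  split_ifs <;> simp only [Comp.ev_bind, Comp.ev_op, Comp.ev_spectralOp]

/-- Since `z_t` and `M_t` are drawn independently given the state, the average over `z_t` can be
moved inside the one over `M_t`, and then into the accumulated sum by `value_sum`. -/
theorem ev_loop {O : Oracle m n} {B : Matrix (Fin m) (Fin n) ℝ} {p : Fin n → ℝ} {η ε : ℝ}
    {cv : Matrix (Fin m) (Fin m) ℝ → Comp (Matrix (Fin m) (Fin m) ℝ)} (φ : Assignment n → ℝ≥0∞)
    (hε : 0 < ε) (hθ : 0 < 2 * Real.log m / (ε * η)) (T : ℕ) :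
    ∀ s : State m n, HistOK s → (loop O B p η ε cv T s).ev (fun o => o.elim 0 φ)
      = value O B p η ε cv φ T s.W s.S s.α (histSum φ s.hist) := by
  induction T with
  | zero => intro s _; simp [loop, value, Comp.ev_pure]
  | succ T ih =>
    intro s hs
    simp only [loop, value, Comp.ev_bind, Comp.ev_op]
    split_ifs with h
    · rw [Comp.ev_bind, ev_iteration]
      simp only [← Comp.ev_const_mul]
      rw [← Comp.ev_sum]
      congr 1
      funext M
      split_ifs with hM
      · simp only [Comp.ev_pure, Option.elim_some]
      · have ha : 0 ≤ ε / (6 * opNorm M) := by have := opNorm_nonneg M; positivity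
        simp only [ih _ (hs.cons ha _ _ _)]
        rw [← value_sum]
        congr 1
        simp only [histSum, List.map_cons, List.sum_cons, mul_add, Finset.sum_add_distrib]
        rw [← Finset.sum_mul, sum_pmf_eq_one, one_mul, add_comm, Finset.mul_sum]
        simp only [mul_left_comm]
    · exact ev_draw hs (hθ.trans_le (not_lt.1 h)) φ

open Matrix

/-! ## Covariance matrices of feasible assignments -/

theorem sum_toReal_pmf {α : Type} [Fintype α] (μ : PMF α) : ∑ z, (μ z).toReal = 1 := by
  rw [← ENNReal.toReal_sum fun z _ => μ.apply_ne_top z, sum_pmf_eq_one, ENNReal.toReal_one]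

theorem sum_pmf_mul_ofReal {α : Type} [Fintype α] (μ : PMF α) {f : α → ℝ} (hf : ∀ z, 0 ≤ f z) :
    ∑ z, μ z * ENNReal.ofReal (f z) = ENNReal.ofReal (∑ z, (μ z).toReal * f z) := by
  rw [ENNReal.ofReal_sum_of_nonneg fun z _ => mul_nonneg ENNReal.toReal_nonneg (hf z)]
  refine Finset.sum_congr rfl fun z _ => ?_
  rw [ENNReal.ofReal_mul ENNReal.toReal_nonneg, ENNReal.ofReal_toReal (μ.apply_ne_top z)]

/-- The deviation of an assignment from the mean `2p - 1`. -/
def dev (p : Fin n → ℝ) (z : Assignment n) : Fin n → ℝ := fun i => toVec z i - (2 * p i - 1)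

theorem pmf_map_apply_eq_sum {α : Type} [DecidableEq α] (μ : PMF (Assignment n))
    (f : Assignment n → α) (a : α) : μ.map f a = ∑ z, μ z * if f z = a then 1 else 0 := by
  rw [PMF.map_apply, tsum_fintype]
  refine Finset.sum_congr rfl fun z _ => ?_
  simp only [mul_ite, mul_one, mul_zero, eq_comm]
  congr

theorem Feasible.sum_dev {p : Fin n → ℝ} {μ : PMF (Assignment n)} (h : Feasible p μ)
    (hp : ∀ i, 0 ≤ p i) : ∑ z, (μ z).toReal • dev p z = 0 := by
  funext i
  have h1 := (h i).1
  rw [pmf_map_apply_eq_sum] at h1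
  have h2 := congrArg ENNReal.toReal h1
  rw [ENNReal.toReal_ofReal (hp i), ENNReal.toReal_sum] at h2
  · have e : ∀ z : Assignment n, (μ z).toReal * dev p z i
        = 2 * (μ z * if z i = 1 then 1 else 0).toReal - (μ z).toReal * (2 * p i) := by
      intro z
      rcases Int.units_eq_one_or (z i) with hz | hz <;> simp [dev, toVec, hz] <;> ring
    simp only [Finset.sum_apply, Pi.smul_apply, smul_eq_mul, Pi.zero_apply, e,
      Finset.sum_sub_distrib, ← Finset.mul_sum, ← Finset.sum_mul, h2, sum_toReal_pmf]
    ring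
  · intro z _
    split_ifs <;> simp [μ.apply_ne_top]

/-- Feasibility fixes the mean, so the centring no longer depends on `μ` and the covariance becomes
linear in the law. -/
theorem Feasible.covB_eq {p : Fin n → ℝ} {μ : PMF (Assignment n)} (h : Feasible p μ)
    (hp : ∀ i, 0 ≤ p i) (B : Matrix (Fin m) (Fin n) ℝ) :
    covB B μ = ∑ z, (μ z).toReal • vecMulVec (B *ᵥ dev p z) (B *ᵥ dev p z) := by
  have hmean : ∀ z, B *ᵥ toVec z - mean μ (fun z => B *ᵥ toVec z) = B *ᵥ dev p z := by
    intro z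
    have h0 := congrArg (fun d => B *ᵥ d) (h.sum_dev hp)
    have e : ∀ z, toVec z = dev p z + fun i => 2 * p i - 1 := fun z => by
      funext i; simp [dev]
    have e2 : mean μ (fun z => B *ᵥ toVec z) = B *ᵥ fun i => 2 * p i - 1 := by
      rw [mean]
      calc ∑ z, (μ z).toReal • B *ᵥ toVec z
          = B *ᵥ (∑ z, (μ z).toReal • dev p z)
            + (∑ z, (μ z).toReal) • B *ᵥ fun i => 2 * p i - 1 := by
              simp only [mulVec_sum, mulVec_smul, Finset.sum_smul, ← Finset.sum_add_distrib,
                ← smul_add]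
              refine Finset.sum_congr rfl fun z _ => ?_
              rw [e z, mulVec_add]
        _ = _ := by rw [h.sum_dev hp, sum_toReal_pmf, mulVec_zero, zero_add, one_smul]
    rw [e2, e z, mulVec_add, add_sub_cancel_right]
  simp only [covB, cov, hmean]

theorem posSemidef_vecMulVec_self (y : Fin m → ℝ) : (vecMulVec y y).PosSemidef := by
  simpa using posSemidef_vecMulVec_self_star y

theorem posSemidef_covB (B : Matrix (Fin m) (Fin n) ℝ) (μ : PMF (Assignment n)) :
    (covB B μ).PosSemidef :=
  posSemidef_sum _ fun _ _ => (posSemidef_vecMulVec_self _).smul ENNReal.toReal_nonneg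

theorem dotProduct_vecMulVec_self_mulVec (v y : Fin m → ℝ) :
    v ⬝ᵥ (vecMulVec y y *ᵥ v) = (v ⬝ᵥ y) ^ 2 := by
  rw [vecMulVec_mulVec, dotProduct_smul, dotProduct_comm y v]
  simp [pow_two]

theorem Feasible.dotProduct_covB {p : Fin n → ℝ} {μ : PMF (Assignment n)} (h : Feasible p μ)
    (hp : ∀ i, 0 ≤ p i) (B : Matrix (Fin m) (Fin n) ℝ) (v : Fin m → ℝ) :
    v ⬝ᵥ (covB B μ *ᵥ v) = ∑ z, (μ z).toReal * (v ⬝ᵥ (B *ᵥ dev p z)) ^ 2 := by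
  rw [h.covB_eq hp, sum_mulVec, dotProduct_sum]
  refine Finset.sum_congr rfl fun z _ => ?_
  rw [smul_mulVec, dotProduct_smul, dotProduct_vecMulVec_self_mulVec, smul_eq_mul]

/-- The squared component of `B (z - E z)` in direction `v`. -/
def sqDev (B : Matrix (Fin m) (Fin n) ℝ) (p : Fin n → ℝ) (v : Fin m → ℝ) (z : Assignment n) :
    ℝ≥0∞ := ENNReal.ofReal ((v ⬝ᵥ (B *ᵥ dev p z)) ^ 2)

theorem Feasible.sum_sqDev {p : Fin n → ℝ} {μ : PMF (Assignment n)} (h : Feasible p μ)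
    (hp : ∀ i, 0 ≤ p i) (B : Matrix (Fin m) (Fin n) ℝ) (v : Fin m → ℝ) :
    ∑ z, μ z * sqDev B p v z = ENNReal.ofReal (v ⬝ᵥ (covB B μ *ᵥ v)) := by
  rw [h.dotProduct_covB hp]
  exact sum_pmf_mul_ofReal μ fun z => sq_nonneg _

/-! ## The covariance of the result -/

/-- If the oracle is used with an estimate `M` of the covariance matrix, the weights grow at the
rate `η` plus the error of the estimate. -/
theorem trace_exp_update_le {S M C : Matrix (Fin m) (Fin m) ℝ} {η ε : ℝ} (hε : 0 < ε) (hε1 : ε < 1)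
    (hS : S.PosSemidef) (hM : M.PosSemidef) (hM0 : opNorm M ≠ 0) (hC : C.PosSemidef)
    (hO : (C * (NormedSpace.exp S)ᵀ).trace ≤ η * (NormedSpace.exp S).trace) :
    (NormedSpace.exp (S + (ε / (6 * opNorm M)) • M)).trace ≤ (NormedSpace.exp S).trace *
      Real.exp ((1 + ε / 6) * ((η + (M - C).frob) * (ε / (6 * opNorm M)))) := by
  have hν : 0 < opNorm M := lt_of_le_of_ne (opNorm_nonneg M) (Ne.symm hM0)
  have ha : 0 ≤ ε / (6 * opNorm M) := by positivity
  have hW := hS.isSymm.posDef_exp.posSemidef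
  refine trace_exp_add_smul_le hS.isSymm hM ha ?_ (by positivity) (by linarith) ?_
  -- The step size makes the norm of the increment exactly `ε / 6`.
  · have := (posSemidef_opNorm_sub hM.isSymm).smul ha
    rw [smul_sub, smul_smul] at this
    convert this using 3
    field_simp
  · rw [hW.isSymm] at hO
    have hs : (M - C).IsSymm := hM.isSymm.sub hC.isSymm
    have := trace_mul_le_of_posSemidef_sub hs.posSemidef_frob_sub hW
    rw [sub_mul, trace_sub, Matrix.smul_mul, one_mul, trace_smul, smul_eq_mul] at this
    linarith

/-- Here `d` is the sum of the errors `‖M_τ - C_τ‖_F` so far. Using `α d` instead of the sharper `∑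
α_τ ‖M_τ - C_τ‖_F` decouples the error from the step size, which depends on the same random `M_τ`;
the bound is then affine in `d` and survives averaging. -/
theorem value_le {O : Oracle m n} {B : Matrix (Fin m) (Fin n) ℝ} {p : Fin n → ℝ} {η ε : ℝ}
    {cv : Matrix (Fin m) (Fin m) ℝ → Comp (Matrix (Fin m) (Fin m) ℝ)} (hm : 2 ≤ m)
    (hp : ∀ i, 0 ≤ p i) (hη : 0 < η) (hO : IsOracle O B p η) (hε : 0 < ε) (hε1 : ε < 1)
    {ebar : ℝ} (hebar : 0 ≤ ebar)
    (hcv : ∀ W : Matrix (Fin m) (Fin m) ℝ, W.PosDef → (cv W).Sat fun M _ => M.PosSemidef)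
    (herr : ∀ W : Matrix (Fin m) (Fin m) ℝ, W.PosDef →
      (cv W).ev (fun M => ENNReal.ofReal (M - covB B (O B W p)).frob) ≤ ENNReal.ofReal ebar)
    {v : Fin m → ℝ} (hv : v ⬝ᵥ v = 1) (T : ℕ) :
    ∀ (S : Matrix (Fin m) (Fin m) ℝ) (α d : ℝ) (x : ℝ≥0∞), S.PosSemidef → 0 ≤ α → 0 ≤ d →
      x ≤ ENNReal.ofReal (v ⬝ᵥ (S *ᵥ v) + α * d) →
      (NormedSpace.exp S).trace ≤ m * Real.exp ((1 + ε / 6) * ((η + d) * α)) →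
      value O B p η ε cv (sqDev B p v) T (NormedSpace.exp S) S α x
        ≤ ENNReal.ofReal ((1 + 2 * ε / 3) * η + 3 * (d + T * ebar)) := by
  have hm0 : (0 : ℝ) < m := by positivity
  have hlog : 0 < Real.log m := Real.log_pos (by exact_mod_cast hm)
  induction T with
  | zero => intro S α d x _ _ _ _ _; simp [value]
  | succ T ih =>
    intro S α d x hS hα hd hx htr
    have hW := hS.isSymm.posDef_exp
    have hq := (hO _ hW).1.sum_sqDev hp B v
    set C := covB B (O B (NormedSpace.exp S) p) with hCdef
    have hC : C.PosSemidef := posSemidef_covB _ _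
    simp only [value, hq]
    split_ifs with h
    · calc _ ≤ (cv (NormedSpace.exp S)).ev (fun M =>
            ENNReal.ofReal ((1 + 2 * ε / 3) * η + 3 * (d + T * ebar))
              + 3 * ENNReal.ofReal (M - C).frob) := ?_
        _ ≤ ENNReal.ofReal ((1 + 2 * ε / 3) * η + 3 * (d + T * ebar))
              + 3 * ENNReal.ofReal ebar := by
            rw [Comp.ev_add, Comp.ev_const, Comp.ev_const_mul]
            gcongr
            exact herr _ hW
        _ = _ := by
            rw [show (3 : ℝ≥0∞) = ENNReal.ofReal 3 by norm_num,
              ← ENNReal.ofReal_mul (p := 3) (by norm_num), ← ENNReal.ofReal_add (by positivity)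
              (by positivity)]
            congr 1
            push_cast
            ring
      refine (hcv _ hW).ev_mono fun M _ hM => ?_
      have he := (M - C).frob_nonneg
      have hCM : v ⬝ᵥ (C *ᵥ v) ≤ v ⬝ᵥ (M *ᵥ v) + (M - C).frob := by
        have := (-(M - C)).dotProduct_mulVec_le_frob v
        rw [frob_neg, hv, mul_one, neg_mulVec, dotProduct_neg, sub_mulVec, dotProduct_sub] at this
        linarith
      rw [show (3 : ℝ≥0∞) = ENNReal.ofReal 3 by norm_num,
        ← ENNReal.ofReal_mul (p := 3) (by norm_num), ← ENNReal.ofReal_add (by positivity) (by positivity)]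
      split_ifs with hM0
      · refine ENNReal.ofReal_le_ofReal ?_
        rw [opNorm_eq_zero.1 hM0] at hCM ⊢
        rw [opNorm_eq_zero.1 hM0] at he
        rw [zero_mulVec, dotProduct_zero] at hCM
        have : 0 ≤ (1 + 2 * ε / 3) * η + 3 * (d + T * ebar) := by positivity
        linarith
      · have hν : 0 < opNorm M := lt_of_le_of_ne (opNorm_nonneg M) (Ne.symm hM0)
        have hup := trace_exp_update_le hε hε1 hS hM hM0 hC (hO _ hW).2
        set a := ε / (6 * opNorm M)
        have ha : 0 ≤ a := by positivity
        have hMv : 0 ≤ v ⬝ᵥ (M *ᵥ v) := by simpa using hM.dotProduct_mulVec_nonneg v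
        have hSv : 0 ≤ v ⬝ᵥ (S *ᵥ v) := by simpa using hS.dotProduct_mulVec_nonneg v
        have hCv : 0 ≤ v ⬝ᵥ (C *ᵥ v) := by simpa using hC.dotProduct_mulVec_nonneg v
        refine (ih (S + a • M) (α + a) (d + (M - C).frob) _ (hS.add (hM.smul ha)) (by positivity)
          (by positivity) ?_ ?_).trans (le_of_eq (by ring_nf))
        -- With `e` the new error, `a vᵀCv ≤ a vᵀMv + a e`, and `α d + a e ≤ (α + a) (d + e)`.
        · rw [← ENNReal.ofReal_mul ha]
          refine (add_le_add_left hx _).trans ?_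
          rw [← ENNReal.ofReal_add (by positivity) (by positivity)]
          refine ENNReal.ofReal_le_ofReal ?_
          rw [add_mulVec, dotProduct_add, smul_mulVec, dotProduct_smul, smul_eq_mul]
          nlinarith [mul_le_mul_of_nonneg_left hCM ha, mul_nonneg hα he, mul_nonneg ha hd]
        · refine hup.trans ((mul_le_mul_of_nonneg_right htr (Real.exp_nonneg _)).trans ?_)
          rw [mul_assoc, ← Real.exp_add]
          refine mul_le_mul_of_nonneg_left (Real.exp_le_exp.2 ?_) hm0.le
          rw [← mul_add]
          refine mul_le_mul_of_nonneg_left ?_ (by positivity)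
          nlinarith [mul_nonneg hα he, mul_nonneg ha hd]
    · rw [not_lt, div_le_iff₀ (by positivity)] at h
      have hα' : 0 < α := by
        rcases hα.eq_or_lt with h0 | h0
        · rw [← h0, zero_mul] at h; linarith
        · exact h0
      -- At exit `vᵀSv ≤ ln m + (1 + ε/6) (η + d) α` and `2 ln m ≤ ε η α`. After division by `α` the
      -- excess over `η` is `εη/2 + εη/6 = 2εη/3`, and `d` has coefficient `2 + ε/6 ≤ 3`.
      have hL := dotProduct_mulVec_le_of_posSemidef_sub hS.isSymm.posSemidef_log_trace_exp_sub v
      rw [smul_mulVec, one_mulVec, dotProduct_smul, hv, smul_eq_mul, mul_one] at hL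
      have htr0 : 0 < (NormedSpace.exp S).trace := by
        have : Nonempty (Fin m) := ⟨⟨0, by omega⟩⟩
        exact hW.trace_pos
      have hlt := Real.log_le_log htr0 htr
      rw [Real.log_mul hm0.ne' (Real.exp_pos _).ne', Real.log_exp] at hlt
      refine (ENNReal.div_le_div_right hx _).trans ?_
      rw [← ENNReal.ofReal_div_of_pos hα']
      refine ENNReal.ofReal_le_ofReal ?_
      rw [div_le_iff₀ hα']
      have h1 : 0 ≤ (T + 1 : ℝ) * ebar * α := by positivity
      have h2 : 0 ≤ d * α * (1 - ε) := by
        have : 0 ≤ 1 - ε := by linarith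
        positivity
      have h3 : 0 ≤ d * α := by positivity
      push_cast
      nlinarith

/-! ## Empirical covariance matrices -/

/-- The inner product `⟨X, Y⟩ = tr(X Yᵀ)`, entrywise. -/
def entryInner (X Y : Matrix (Fin m) (Fin m) ℝ) : ℝ := ∑ i, ∑ j, X i j * Y i j

theorem frob_add_sq (X Y : Matrix (Fin m) (Fin m) ℝ) :
    (X + Y).frob ^ 2 = X.frob ^ 2 + 2 * entryInner X Y + Y.frob ^ 2 := by
  simp only [frob_sq, entryInner, Finset.mul_sum, ← Finset.sum_add_distrib, Matrix.add_apply]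
  exact Finset.sum_congr rfl fun i _ => Finset.sum_congr rfl fun j _ => by ring

theorem entryInner_sum_smul {ι : Type} [Fintype ι] (X : Matrix (Fin m) (Fin m) ℝ) (c : ι → ℝ)
    (D : ι → Matrix (Fin m) (Fin m) ℝ) :
    entryInner X (∑ z, c z • D z) = ∑ z, c z * entryInner X (D z) := by
  simp only [entryInner, Matrix.sum_apply, Matrix.smul_apply, smul_eq_mul, Finset.mul_sum]
  rw [Finset.sum_congr rfl fun i _ => Finset.sum_comm, Finset.sum_comm]
  exact Finset.sum_congr rfl fun z _ => Finset.sum_congr rfl fun i _ =>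
    Finset.sum_congr rfl fun j _ => by ring

theorem frob_vecMulVec_self_sq (y : Fin m → ℝ) : (vecMulVec y y).frob ^ 2 = (y ⬝ᵥ y) ^ 2 := by
  rw [frob_sq, pow_two, dotProduct, Finset.sum_mul_sum]
  exact Finset.sum_congr rfl fun i _ => Finset.sum_congr rfl fun j _ => by
    rw [vecMulVec_apply]; ring

theorem abs_dev_le {p : Fin n → ℝ} (hp : ∀ i, 0 < p i ∧ p i < 1) (z : Assignment n) (i : Fin n) :
    |dev p z i| ≤ 2 := by
  have := hp i
  rcases Int.units_eq_one_or (z i) with hz | hz <;> simp only [dev, toVec, hz] <;>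
    rw [abs_le] <;> constructor <;> push_cast <;> linarith

theorem dotProduct_mulVec_dev_le {B : Matrix (Fin m) (Fin n) ℝ} (hB : ColumnsLeOne B)
    {p : Fin n → ℝ} (hp : ∀ i, 0 < p i ∧ p i < 1) (z : Assignment n) :
    (B *ᵥ dev p z) ⬝ᵥ (B *ᵥ dev p z) ≤ 4 * (n : ℝ) ^ 2 := by
  have e : (WithLp.toLp 2 (B *ᵥ dev p z) : EuclideanSpace ℝ (Fin m))
      = ∑ j, dev p z j • (WithLp.toLp 2 (fun i => B i j) : EuclideanSpace ℝ (Fin m)) := by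
    ext i
    simp [mulVec, dotProduct, mul_comm]
  have hn : ‖(WithLp.toLp 2 (B *ᵥ dev p z) : EuclideanSpace ℝ (Fin m))‖ ≤ 2 * n := by
    rw [e]
    calc _ ≤ ∑ j : Fin n, (2 : ℝ) := by
          refine norm_sum_le_of_le _ fun j _ => ?_
          rw [norm_smul]
          calc _ ≤ 2 * (1 : ℝ) := mul_le_mul (abs_dev_le hp z j) (hB j) (norm_nonneg _) (by norm_num)
            _ = 2 := mul_one _
      _ = 2 * n := by simp [mul_comm]
  have h2 : ‖(WithLp.toLp 2 (B *ᵥ dev p z) : EuclideanSpace ℝ (Fin m))‖ ^ 2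
      = (B *ᵥ dev p z) ⬝ᵥ (B *ᵥ dev p z) := by
    rw [EuclideanSpace.real_norm_sq_eq]; simp [dotProduct, pow_two]
  rw [← h2]
  calc _ ≤ (2 * (n : ℝ)) ^ 2 := pow_le_pow_left₀ (norm_nonneg _) hn 2
    _ = _ := by ring

theorem trace_vecMulVec_self (y : Fin m → ℝ) : (vecMulVec y y).trace = y ⬝ᵥ y := by
  simp [trace, dotProduct, vecMulVec_apply]

/-- The trace bound holds for every outcome, not just on average; this is what makes termination
certain with random estimates. -/
theorem sat_scatter (O : Oracle m n) {B : Matrix (Fin m) (Fin n) ℝ} (hB : ColumnsLeOne B)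
    {p : Fin n → ℝ} (hp : ∀ i, 0 < p i ∧ p i < 1) (W : Matrix (Fin m) (Fin m) ℝ) (k : ℕ) :
    (scatter O B p W k).Sat fun S c => S.PosSemidef ∧ S.trace ≤ k * (4 * (n : ℝ) ^ 2) ∧
      c.calls = k ∧ c.steps = m * m + k * (3 * (m * n) + 3 * (m * m) + 5 * n + 1) ∧
      c.spectral = 0 := by
  induction k with
  | zero => exact Comp.sat_op ⟨PosSemidef.zero, by simp, rfl, by simp, rfl⟩
  | succ k ih =>
    refine ih.bind fun S c hS => Comp.Sat.bind (P := fun z c => c = _) (Comp.sat_query fun z => rfl)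
      fun z c' hc' => ?_
    subst hc'
    refine Comp.Sat.bind (P := fun d c => d = dev p z ∧ c = ⟨0, 3 * n, 0⟩)
      (Comp.sat_op ⟨rfl, rfl⟩) ?_
    rintro _ _ ⟨rfl, rfl⟩
    refine Comp.Sat.bind (P := fun y c => y = B *ᵥ dev p z ∧ c = ⟨0, 2 * m * n, 0⟩)
      (Comp.sat_op ⟨rfl, rfl⟩) ?_
    rintro _ _ ⟨rfl, rfl⟩
    refine Comp.sat_op ?_
    obtain ⟨h1, h2, h3, h4, h5⟩ := hS
    refine ⟨h1.add (posSemidef_vecMulVec_self _), ?_, ?_, ?_, ?_⟩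
    · rw [trace_add, trace_vecMulVec_self]
      have := dotProduct_mulVec_dev_le hB hp z
      push_cast
      linarith
    · simp [Cost.add, h3]
    · simp only [Cost.add, h4]; ring
    · simp [Cost.add, h5]

theorem sat_empiricalCov {N : ℕ} (hN : 0 < N) (O : Oracle m n) {B : Matrix (Fin m) (Fin n) ℝ}
    (hB : ColumnsLeOne B) {p : Fin n → ℝ} (hp : ∀ i, 0 < p i ∧ p i < 1)
    (W : Matrix (Fin m) (Fin m) ℝ) :
    (empiricalCov N O B p W).Sat fun M c => M.PosSemidef ∧ M.trace ≤ 4 * (n : ℝ) ^ 2 ∧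
      c.calls = N ∧ c.steps = 2 * (m * m) + 1 + N * (3 * (m * n) + 3 * (m * m) + 5 * n + 1) ∧
      c.spectral = 0 := by
  refine (sat_scatter O hB hp W N).bind fun S c hS => Comp.sat_op ?_
  obtain ⟨h1, h2, h3, h4, h5⟩ := hS
  have hN' : (0 : ℝ) < N := by exact_mod_cast hN
  refine ⟨h1.smul (by positivity), ?_, ?_, ?_, ?_⟩
  · rw [trace_smul, smul_eq_mul, inv_mul_le_iff₀ hN']
    exact h2
  · simp [Cost.add, h3]
  · simp only [Cost.add, h4]; ring
  · simp [Cost.add, h5]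

/-- Fresh centred summands are orthogonal in mean to the past, so second moments add up, each at
most `(4 n²)² = 16 n⁴`. -/
theorem ev_scatter_le {O : Oracle m n} {B : Matrix (Fin m) (Fin n) ℝ} (hB : ColumnsLeOne B)
    {p : Fin n → ℝ} (hp : ∀ i, 0 < p i ∧ p i < 1) {W : Matrix (Fin m) (Fin m) ℝ}
    (hf : Feasible p (O B W p)) (k : ℕ) :
    (scatter O B p W k).ev
        (fun S => ENNReal.ofReal ((S - (k : ℝ) • covB B (O B W p)).frob ^ 2))
      ≤ ENNReal.ofReal (k * (16 * (n : ℝ) ^ 4)) := by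
  set μ := O B W p
  set C := covB B μ with hC
  have h1 := sum_toReal_pmf μ
  have hCeq := hf.covB_eq (fun i => (hp i).1.le) B
  induction k with
  | zero => simp [scatter, Comp.ev_op, frob_zero]
  | succ k ih =>
    set Y : Assignment n → Matrix (Fin m) (Fin m) ℝ :=
      fun z => vecMulVec (B *ᵥ dev p z) (B *ᵥ dev p z) with hY
    have hD : ∑ z, (μ z).toReal • (Y z - C) = 0 := by
      simp only [smul_sub, Finset.sum_sub_distrib, ← Finset.sum_smul, h1, one_smul]
      rw [hC, hCeq, sub_self]
    have hip : ∀ X, ∑ z, (μ z).toReal * entryInner X (Y z - C) = 0 := fun X => by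
      rw [← entryInner_sum_smul, hD]; simp [entryInner]
    have hsum : ∀ X, ∑ z, (μ z).toReal * (X + (Y z - C)).frob ^ 2
        = X.frob ^ 2 + ∑ z, (μ z).toReal * (Y z - C).frob ^ 2 := fun X => by
      have : ∀ z, (μ z).toReal * (X + (Y z - C)).frob ^ 2 = (μ z).toReal * X.frob ^ 2
          + 2 * ((μ z).toReal * entryInner X (Y z - C)) + (μ z).toReal * (Y z - C).frob ^ 2 :=
        fun z => by rw [frob_add_sq]; ring
      simp only [this, Finset.sum_add_distrib, ← Finset.mul_sum, ← Finset.sum_mul, hip, h1]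
      ring
    have hvar : ∑ z, (μ z).toReal * (Y z - C).frob ^ 2 ≤ 16 * (n : ℝ) ^ 4 := by
      -- With `X = C` this reads `E‖Y‖² = ‖C‖² + E‖Y - C‖²`, so the variance is at most the second
      -- moment.
      have h2 := hsum C
      simp only [add_sub_cancel] at h2
      have h3 : ∑ z, (μ z).toReal * (Y z).frob ^ 2 ≤ ∑ z, (μ z).toReal * (16 * (n : ℝ) ^ 4) := by
        refine Finset.sum_le_sum fun z _ => mul_le_mul_of_nonneg_left ?_ ENNReal.toReal_nonneg
        rw [hY, frob_vecMulVec_self_sq]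
        have h0 : 0 ≤ (B *ᵥ dev p z) ⬝ᵥ (B *ᵥ dev p z) :=
          Finset.sum_nonneg fun _ _ => mul_self_nonneg _
        calc _ ≤ (4 * (n : ℝ) ^ 2) ^ 2 :=
              pow_le_pow_left₀ h0 (dotProduct_mulVec_dev_le hB hp z) 2
          _ = _ := by ring
      rw [← Finset.sum_mul, h1, one_mul] at h3
      nlinarith [sq_nonneg C.frob]
    simp only [scatter, Comp.ev_bind, Comp.ev_query, Comp.ev_op]
    have hinner : ∀ S : Matrix (Fin m) (Fin m) ℝ,
        ∑ z, μ z * ENNReal.ofReal ((S + Y z - ((k + 1 : ℕ) : ℝ) • C).frob ^ 2)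
          ≤ ENNReal.ofReal ((S - (k : ℝ) • C).frob ^ 2) + ENNReal.ofReal (16 * (n : ℝ) ^ 4) := by
      intro S
      have e : ∀ z, S + Y z - ((k + 1 : ℕ) : ℝ) • C = (S - (k : ℝ) • C) + (Y z - C) := fun z => by
        push_cast; rw [add_smul, one_smul]; abel
      simp only [e]
      rw [sum_pmf_mul_ofReal _ fun _ => sq_nonneg _, hsum,
        ← ENNReal.ofReal_add (sq_nonneg _) (by positivity)]
      exact ENNReal.ofReal_le_ofReal (by linarith)
    refine (Comp.Sat.ev_mono (P := fun _ _ => True) (fun _ _ => trivial)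
      fun S _ _ => hinner S).trans ?_
    rw [Comp.ev_add, Comp.ev_const]
    refine (add_le_add_left ih _).trans ?_
    rw [← ENNReal.ofReal_add (by positivity) (by positivity)]
    exact ENNReal.ofReal_le_ofReal (le_of_eq (by push_cast; ring))

theorem ev_empiricalCov_le {O : Oracle m n} {B : Matrix (Fin m) (Fin n) ℝ} (hB : ColumnsLeOne B)
    {p : Fin n → ℝ} (hp : ∀ i, 0 < p i ∧ p i < 1) {W : Matrix (Fin m) (Fin m) ℝ}
    (hf : Feasible p (O B W p)) {N : ℕ} {δ : ℝ} (hδ : 0 < δ) (hN0 : 0 < N)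
    (hN : 16 * (n : ℝ) ^ 4 ≤ δ ^ 2 * N) :
    (empiricalCov N O B p W).ev (fun M => ENNReal.ofReal (M - covB B (O B W p)).frob)
      ≤ ENNReal.ofReal δ := by
  have hN' : (0 : ℝ) < N := by exact_mod_cast hN0
  simp only [empiricalCov, Comp.ev_bind, Comp.ev_op]
  set C := covB B (O B W p)
  -- The pointwise inequality `f ≤ δ/2 + f²/(2δ)` passes from the second moment to the first; the
  -- sample size makes the second term at most `δ/2` in mean.
  have hpt : ∀ S : Matrix (Fin m) (Fin m) ℝ, ENNReal.ofReal ((N : ℝ)⁻¹ • S - C).frob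
      ≤ ENNReal.ofReal (δ / 2) + ENNReal.ofReal (1 / (2 * δ * N ^ 2))
        * ENNReal.ofReal ((S - (N : ℝ) • C).frob ^ 2) := by
    intro S
    rw [← ENNReal.ofReal_mul (by positivity), ← ENNReal.ofReal_add (by positivity) (by positivity)]
    refine ENNReal.ofReal_le_ofReal ?_
    have e : S - (N : ℝ) • C = (N : ℝ) • ((N : ℝ)⁻¹ • S - C) := by
      rw [smul_sub, smul_smul, mul_inv_cancel₀ hN'.ne', one_smul]
    rw [e, frob_smul]
    set f := ((N : ℝ)⁻¹ • S - C).frob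
    have : 1 / (2 * δ * (N : ℝ) ^ 2) * ((N : ℝ) ^ 2 * f ^ 2) = f ^ 2 / (2 * δ) := by
      field_simp
    rw [this, div_add_div _ _ two_ne_zero (by positivity), le_div_iff₀ (by positivity)]
    nlinarith [sq_nonneg (δ - f)]
  refine (Comp.Sat.ev_mono (P := fun _ _ => True) (fun _ _ => trivial) fun S _ _ => hpt S).trans ?_
  rw [Comp.ev_add, Comp.ev_const, Comp.ev_const_mul]
  refine (add_le_add_right (mul_le_mul_right (ev_scatter_le hB hp hf N) _) _).trans ?_
  rw [← ENNReal.ofReal_mul (by positivity), ← ENNReal.ofReal_add (by positivity) (by positivity)]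
  refine ENNReal.ofReal_le_ofReal ?_
  have : 1 / (2 * δ * (N : ℝ) ^ 2) * (N * (16 * (n : ℝ) ^ 4)) = 16 * (n : ℝ) ^ 4 / (2 * δ * N) := by
    field_simp
  rw [this]
  have : 16 * (n : ℝ) ^ 4 / (2 * δ * N) ≤ δ / 2 := by
    rw [div_le_iff₀ (by positivity)]
    nlinarith
  linarith

/-! ## Termination and resources -/

/-- The state after an iteration with the matrix `M` and the sample `z`. -/
def nextState (ε : ℝ) (s : State m n) (M : Matrix (Fin m) (Fin m) ℝ) (z : Assignment n) :
    State m n :=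
  ⟨NormedSpace.exp (s.S + (ε / (6 * opNorm M)) • M), s.S + (ε / (6 * opNorm M)) • M,
    s.α + ε / (6 * opNorm M), (ε / (6 * opNorm M), z) :: s.hist⟩

theorem sat_iteration {O : Oracle m n} {B : Matrix (Fin m) (Fin n) ℝ} {p : Fin n → ℝ} {ε : ℝ}
    {cv : Matrix (Fin m) (Fin m) ℝ → Comp (Matrix (Fin m) (Fin m) ℝ)} {s : State m n}
    {kc ks : ℕ} {P : Matrix (Fin m) (Fin m) ℝ → Prop}
    (hcv : (cv s.W).Sat fun M c => P M ∧ c.calls ≤ kc ∧ c.steps ≤ ks ∧ c.spectral = 0) :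
    (iteration O B p ε cv s).Sat fun r c =>
      (∀ s', r = Sum.inl s' → ∃ M z, P M ∧ opNorm M ≠ 0 ∧ s' = nextState ε s M z) ∧
      c.calls ≤ kc + 1 ∧ c.steps ≤ ks + m * n + 3 * (m * m) + 3 * n + 6 ∧ c.spectral ≤ 2 := by
  refine Comp.Sat.bind (P := fun z c => c = _) (Comp.sat_query fun z => rfl) fun z c hc => ?_
  subst hc
  refine hcv.bind ?_
  rintro M c ⟨hM, h1, h2, h3⟩
  refine Comp.Sat.bind (P := fun ν c => ν = opNorm M ∧ c = ⟨0, 0, 1⟩)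
    (Comp.sat_spectralOp ⟨rfl, rfl⟩) ?_
  rintro _ _ ⟨rfl, rfl⟩
  split_ifs with h0
  · refine Comp.sat_op ⟨by simp, ?_, ?_, ?_⟩ <;> simp only [Cost.add] <;> nlinarith
  · refine Comp.Sat.bind (P := fun a c => a = ε / (6 * opNorm M) ∧ c = ⟨0, 3, 0⟩)
      (Comp.sat_op ⟨rfl, rfl⟩) ?_
    rintro _ _ ⟨rfl, rfl⟩
    refine Comp.Sat.bind (P := fun S c => S = s.S + (ε / (6 * opNorm M)) • M ∧
      c = ⟨0, 2 * m * m, 0⟩) (Comp.sat_op ⟨rfl, rfl⟩) ?_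
    rintro _ _ ⟨rfl, rfl⟩
    refine Comp.Sat.bind (P := fun W c => W = NormedSpace.exp (s.S + (ε / (6 * opNorm M)) • M) ∧
      c = ⟨0, 0, 1⟩) (Comp.sat_spectralOp ⟨rfl, rfl⟩) ?_
    rintro _ _ ⟨rfl, rfl⟩
    refine Comp.sat_op ⟨?_, ?_, ?_, ?_⟩
    · rintro s' hs'
      exact ⟨M, z, hM, h0, (Sum.inl.inj hs').symm⟩
    all_goals simp only [Cost.add]; nlinarith

/-- The loop terminates if some potential grows by one in each round and is bounded by `K` while the
loop is running. -/
theorem sat_loop {O : Oracle m n} {B : Matrix (Fin m) (Fin n) ℝ} {p : Fin n → ℝ} {η ε : ℝ}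
    {cv : Matrix (Fin m) (Fin m) ℝ → Comp (Matrix (Fin m) (Fin m) ℝ)}
    (hθ : 0 < 2 * Real.log m / (ε * η)) {Good : State m n → Prop} {pot : State m n → ℝ} {K : ℝ}
    {kc ks : ℕ} (hhist : ∀ s, Good s → HistOK s)
    (hcv : ∀ s, Good s → (cv s.W).Sat fun M c =>
      (opNorm M ≠ 0 → ∀ z, Good (nextState ε s M z) ∧ pot s + 1 ≤ pot (nextState ε s M z)) ∧
      c.calls ≤ kc ∧ c.steps ≤ ks ∧ c.spectral = 0)
    (hK : ∀ s, Good s → s.α < 2 * Real.log m / (ε * η) → pot s < K) (T : ℕ) :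
    ∀ s, Good s → K ≤ pot s + T → (loop O B p η ε cv (T + 1) s).Sat fun o c => o.isSome ∧
      c.calls ≤ T * (kc + 1) ∧
      c.steps ≤ T * (ks + m * n + 3 * (m * m) + 3 * n + 13) + 2 * s.hist.length + 6 ∧
      c.spectral ≤ 2 * T := by
  induction T with
  | zero =>
    intro s hs hpot
    refine Comp.Sat.bind (P := fun θ c => θ = 2 * Real.log m / (ε * η) ∧ c = ⟨0, 5, 0⟩)
      (Comp.sat_op ⟨rfl, rfl⟩) ?_
    rintro _ _ ⟨rfl, rfl⟩
    -- No iteration is left, but the potential has reached `K`, so the extra round only performs the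
    -- exit test and the final draw.
    have h : ¬ s.α < 2 * Real.log m / (ε * η) := fun h => by
      have := hK s hs h
      rw [Nat.cast_zero, add_zero] at hpot
      linarith
    rw [if_neg h]
    refine (sat_draw (hhist s hs) (hθ.trans_le (not_lt.1 h))).mono ?_
    rintro o _ ⟨ho, rfl⟩
    refine ⟨ho, ?_, ?_, ?_⟩ <;> simp only [Cost.add] <;> omega
  | succ T ih =>
    intro s hs hpot
    rw [loop]
    refine Comp.Sat.bind (P := fun θ c => θ = 2 * Real.log m / (ε * η) ∧ c = ⟨0, 5, 0⟩)
      (Comp.sat_op ⟨rfl, rfl⟩) ?_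
    rintro _ _ ⟨rfl, rfl⟩
    split_ifs with h
    · refine (sat_iteration (hcv s hs)).bind ?_
      rintro (s' | z) c ⟨h1, h2, h3, h4⟩
      · obtain ⟨M, z, hM, hM0, rfl⟩ := h1 _ rfl
        obtain ⟨hg, hp1⟩ := hM hM0 z
        refine (ih _ hg (by push_cast at hpot; linarith)).mono ?_
        rintro o d ⟨g1, g2, g3, g4⟩
        -- The constant 13 per round consists of 6 steps of the iteration, 5 for the threshold, and
        -- 2 for the new history entry in the final draw.
        have hl : (nextState ε s M z).hist.length = s.hist.length + 1 := rfl
        rw [hl] at g3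
        refine ⟨g1, ?_, ?_, ?_⟩ <;> simp only [Cost.add] <;> nlinarith
      · refine Comp.sat_pure ⟨rfl, ?_, ?_, ?_⟩ <;> simp only [Cost.add]
        · nlinarith [Nat.zero_le (T * (kc + 1))]
        · nlinarith [Nat.zero_le (T * (ks + m * n + 3 * (m * m) + 3 * n + 13))]
        · omega
    · refine (sat_draw (hhist s hs) (hθ.trans_le (not_lt.1 h))).mono ?_
      rintro o _ ⟨ho, rfl⟩
      refine ⟨ho, ?_, ?_, ?_⟩ <;> simp only [Cost.add]
      · positivity
      · have := Nat.zero_le ((T + 1) * (ks + m * n + 3 * (m * m) + 3 * n + 13))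
        omega
      · positivity

/-! ## The law of the result -/

/-- Used for coordinate indicators, whose expectation is the same under all oracle laws: a weighted
average of equal numbers does not depend on the random weights. An upper bound is enough, since the
probabilities of `1` and `-1` sum to one. -/
theorem value_le_of_forall_sum_eq {O : Oracle m n} {B : Matrix (Fin m) (Fin n) ℝ} {p : Fin n → ℝ}
    {η ε : ℝ} {cv : Matrix (Fin m) (Fin m) ℝ → Comp (Matrix (Fin m) (Fin m) ℝ)} (hε : 0 < ε)
    (hcv : ∀ W : Matrix (Fin m) (Fin m) ℝ, W.PosDef → (cv W).Sat fun M _ => M.PosSemidef)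
    {φ : Assignment n → ℝ≥0∞} {c : ℝ≥0∞}
    (hφ : ∀ W : Matrix (Fin m) (Fin m) ℝ, W.PosDef → ∑ z, O B W p z * φ z = c) (T : ℕ) :
    ∀ (S : Matrix (Fin m) (Fin m) ℝ) (α : ℝ) (x : ℝ≥0∞), S.PosSemidef → 0 ≤ α →
      x ≤ ENNReal.ofReal α * c → value O B p η ε cv φ T (NormedSpace.exp S) S α x ≤ c := by
  induction T with
  | zero => intro S α x _ _ _; simp [value]
  | succ T ih =>
    intro S α x hS hα hx
    have hW := hS.isSymm.posDef_exp
    simp only [value, hφ _ hW]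
    split_ifs with h
    · calc _ ≤ (cv (NormedSpace.exp S)).ev (fun _ => c) := ?_
        _ = c := Comp.ev_const _ _
      refine (hcv _ hW).ev_mono fun M _ hM => ?_
      split_ifs with hM0
      · exact le_rfl
      · have ha : 0 ≤ ε / (6 * opNorm M) := by have := opNorm_nonneg M; positivity
        refine ih _ _ _ (hS.add (hM.smul ha)) (by positivity) ?_
        rw [ENNReal.ofReal_add hα ha, add_mul]
        gcongr
    · exact ENNReal.div_le_of_le_mul' hx

theorem ev_run {O : Oracle m n} {B : Matrix (Fin m) (Fin n) ℝ} {p : Fin n → ℝ} {η ε : ℝ}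
    {cv : Matrix (Fin m) (Fin m) ℝ → Comp (Matrix (Fin m) (Fin m) ℝ)} (φ : Assignment n → ℝ≥0∞)
    (hε : 0 < ε) (hθ : 0 < 2 * Real.log m / (ε * η)) (T : ℕ) :
    (run O B p η ε cv T).ev (fun o => o.elim 0 φ)
      = value O B p η ε cv φ T (NormedSpace.exp 0) 0 0 0 := by
  rw [run, Comp.ev_bind, Comp.ev_op, ev_loop φ hε hθ T _ ⟨by simp, by simp⟩]
  simp [histSum]

theorem exists_law_of_isSome {α : Type} [Inhabited α] {c : Comp (Option α)}
    {R : Cost → Prop} (h : c.Sat fun o k => o.isSome ∧ R k) :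
    ∃ ρ : PMF (α × Cost), c.law = ρ.map (fun r => (some r.1, r.2)) ∧
      (∀ r ∈ ρ.support, R r.2) ∧
      ∀ φ : α → ℝ≥0∞, ∑' a, ρ.map Prod.fst a * φ a = c.ev fun o => o.elim 0 φ := by
  refine ⟨c.law.map fun r => (r.1.getD default, r.2), ?_, ?_, fun φ => ?_⟩
  · rw [PMF.map_comp, PMF.map, PMF.bind]
    refine PMF.ext fun r => ?_
    change c.law r = ∑' a, _
    rw [tsum_eq_single r]
    · by_cases hr : r ∈ c.law.support
      · obtain ⟨a, ha⟩ := Option.isSome_iff_exists.1 (h r hr).1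
        have : (some (r.1.getD default), r.2) = r := by
          ext1 <;> simp [ha]
        simp [this]
      · rw [(PMF.apply_eq_zero_iff _ _).2 hr, zero_mul]
    · intro q hq
      by_cases hr : q ∈ c.law.support
      · obtain ⟨a, ha⟩ := Option.isSome_iff_exists.1 (h q hr).1
        have : (some (q.1.getD default), q.2) = q := by
          ext1 <;> simp [ha]
        simp [this, hq.symm]
      · rw [(PMF.apply_eq_zero_iff _ _).2 hr, zero_mul]
  · intro r hr
    obtain ⟨q, hq, rfl⟩ := (PMF.mem_support_map_iff _ _ _).1 hr
    exact (h q hq).2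
  · rw [tsum_map_mul, tsum_map_mul, Comp.ev]
    refine tsum_congr fun r => ?_
    by_cases hr : r ∈ c.law.support
    · obtain ⟨a, ha⟩ := Option.isSome_iff_exists.1 (h r hr).1
      simp [ha]
    · rw [(PMF.apply_eq_zero_iff _ _).2 hr, zero_mul, zero_mul]

theorem feasible_of_le {p : Fin n → ℝ} (hp : ∀ i, 0 < p i ∧ p i < 1) {μ : PMF (Assignment n)}
    (h : ∀ i, μ.map (fun z => z i) 1 ≤ ENNReal.ofReal (p i) ∧
      μ.map (fun z => z i) (-1) ≤ ENNReal.ofReal (1 - p i)) : Feasible p μ := by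
  intro i
  obtain ⟨h1, h2⟩ := h i
  have hpi := hp i
  have hs : μ.map (fun z => z i) 1 + μ.map (fun z => z i) (-1) = 1 := by
    rw [← sum_pmf_eq_one (μ.map fun z => z i), UnitsInt.univ, Finset.sum_pair (by decide)]
  have hs' : ENNReal.ofReal (p i) + ENNReal.ofReal (1 - p i) = 1 := by
    rw [← ENNReal.ofReal_add hpi.1.le (by linarith)]; simp
  constructor
  · refine le_antisymm h1 (not_lt.1 fun hlt => ?_)
    have := ENNReal.add_lt_add_of_lt_of_le (ne_top_of_le_ne_top ENNReal.ofReal_ne_top h2) hlt h2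
    rw [hs, hs'] at this
    exact lt_irrefl _ this
  · refine le_antisymm h2 (not_lt.1 fun hlt => ?_)
    have := ENNReal.add_lt_add_of_le_of_lt (ne_top_of_le_ne_top ENNReal.ofReal_ne_top h1) h1 hlt
    rw [hs, hs'] at this
    exact lt_irrefl _ this

theorem opNorm_le_of_unit {A : Matrix (Fin m) (Fin m) ℝ} {c : ℝ} (hc : 0 ≤ c) (hA : A.PosSemidef)
    (h : ∀ v, v ⬝ᵥ v = 1 → v ⬝ᵥ (A *ᵥ v) ≤ c) : opNorm A ≤ c := by
  refine opNorm_le_of_posSemidef hc hA (posSemidef_smul_one_sub_of_le hA.isSymm fun v => ?_)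
  rcases eq_or_ne v 0 with rfl | hv
  · simp
  · have hpos : 0 < v ⬝ᵥ v := by
      refine lt_of_le_of_ne (Finset.sum_nonneg fun i _ => mul_self_nonneg _) fun h0 => hv ?_
      exact dotProduct_self_eq_zero.1 h0.symm
    have hr : (√(v ⬝ᵥ v))⁻¹ * (√(v ⬝ᵥ v))⁻¹ = (v ⬝ᵥ v)⁻¹ := by
      rw [← mul_inv, Real.mul_self_sqrt hpos.le]
    have := h ((√(v ⬝ᵥ v))⁻¹ • v) (by
      rw [smul_dotProduct, dotProduct_smul, smul_eq_mul, smul_eq_mul, ← mul_assoc, hr,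
        inv_mul_cancel₀ hpos.ne'])
    rw [mulVec_smul, smul_dotProduct, dotProduct_smul, smul_eq_mul, smul_eq_mul, ← mul_assoc, hr,
      inv_mul_le_iff₀ hpos] at this
    linarith

/-- If the algorithm terminates within `T` rounds and the mean error of the covariance matrices used
is at most `ebar`, then its result is feasible with small covariance. -/
theorem exists_returns {O : Oracle m n} {B : Matrix (Fin m) (Fin n) ℝ} {p : Fin n → ℝ} {η ε : ℝ}
    {cv : Matrix (Fin m) (Fin m) ℝ → Comp (Matrix (Fin m) (Fin m) ℝ)} (hm : 2 ≤ m)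
    (hp : ∀ i, 0 < p i ∧ p i < 1) (hη : 0 < η) (hO : IsOracle O B p η) (hε : 0 < ε) (hε1 : ε < 1)
    {ebar : ℝ} (hebar : 0 ≤ ebar)
    (hcv : ∀ W : Matrix (Fin m) (Fin m) ℝ, W.PosDef → (cv W).Sat fun M _ => M.PosSemidef)
    (herr : ∀ W : Matrix (Fin m) (Fin m) ℝ, W.PosDef →
      (cv W).ev (fun M => ENNReal.ofReal (M - covB B (O B W p)).frob) ≤ ENNReal.ofReal ebar)
    {T : ℕ} (hT : 9 * (T * ebar) ≤ ε * η) {R : Cost → Prop}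
    (hrun : (run O B p η ε cv T).Sat fun o k => o.isSome ∧ R k) :
    ∃ ρ : PMF (Assignment n × Cost), Returns O B p η ε cv ρ ∧ Feasible p (ρ.map Prod.fst) ∧
      opNorm (covB B (ρ.map Prod.fst)) ≤ (1 + ε) * η ∧ ∀ r ∈ ρ.support, R r.2 := by
  have hlog : 0 < Real.log m := Real.log_pos (by exact_mod_cast hm)
  have hθ : 0 < 2 * Real.log m / (ε * η) := by positivity
  have : Inhabited (Assignment n) := ⟨fun _ => 1⟩
  obtain ⟨ρ, hρ, hR, hev⟩ := exists_law_of_isSome hrun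
  have hev' : ∀ φ : Assignment n → ℝ≥0∞, ∑ z, ρ.map Prod.fst z * φ z
      = value O B p η ε cv φ T (NormedSpace.exp 0) 0 0 0 := fun φ => by
    rw [← tsum_fintype (L := .unconditional _), hev, ev_run φ hε hθ]
  have hfeas : Feasible p (ρ.map Prod.fst) := by
    refine feasible_of_le hp fun i => ⟨?_, ?_⟩
    · rw [pmf_map_apply_eq_sum, hev']
      refine value_le_of_forall_sum_eq hε hcv (fun W hW => ?_) T _ _ _ PosSemidef.zero le_rfl
        zero_le
      rw [← ((hO W hW).1 i).1, pmf_map_apply_eq_sum]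
    · rw [pmf_map_apply_eq_sum, hev']
      refine value_le_of_forall_sum_eq hε hcv (fun W hW => ?_) T _ _ _ PosSemidef.zero le_rfl
        zero_le
      rw [← ((hO W hW).1 i).2, pmf_map_apply_eq_sum]
  have hp0 : ∀ i, 0 ≤ p i := fun i => (hp i).1.le
  refine ⟨ρ, ⟨T, hρ⟩, hfeas, ?_, hR⟩
  refine opNorm_le_of_unit (by positivity) (posSemidef_covB _ _) fun v hv => ?_
  -- The run starts with `tr (exp 0) = m` and no error. The bound `hT` makes `3 T ebar` at most
  -- `εη/3`, which completes `2εη/3` to `εη`.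
  have h1 := value_le hm hp0 hη hO hε hε1 hebar hcv herr hv T 0 0 0 0 PosSemidef.zero le_rfl le_rfl
    zero_le (by simp)
  rw [← hev', hfeas.sum_sqDev hp0] at h1
  have h2 := (ENNReal.ofReal_le_ofReal_iff (by positivity)).1 h1
  linarith

/-! ## Explicit covariance matrices -/

/-- The states that the algorithm reaches with explicit covariance matrices. -/
structure ExactGood (η ε : ℝ) (s : State m n) : Prop where
  hist : HistOK s
  posSemidef : s.S.PosSemidef
  W_eq : s.W = NormedSpace.exp s.S
  trace_le : s.W.trace ≤ m * Real.exp ((1 + ε / 6) * (η * s.α))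

theorem ExactGood.next {O : Oracle m n} {B : Matrix (Fin m) (Fin n) ℝ} {p : Fin n → ℝ} {η ε : ℝ}
    (hO : IsOracle O B p η) (hε : 0 < ε) (hε1 : ε < 1) {s : State m n} (hs : ExactGood η ε s)
    (h0 : opNorm (covB B (O B s.W p)) ≠ 0) (z : Assignment n) :
    ExactGood η ε (nextState ε s (covB B (O B s.W p)) z) := by
  have hM := posSemidef_covB B (O B s.W p)
  have ha : 0 ≤ ε / (6 * opNorm (covB B (O B s.W p))) := by
    have := opNorm_nonneg (covB B (O B s.W p)); positivity
  refine ⟨hs.hist.cons ha z _ _, hs.posSemidef.add (hM.smul ha), rfl, ?_⟩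
  have hW := hs.posSemidef.isSymm.posDef_exp
  rw [← hs.W_eq] at hW
  have h1 := (hO _ hW).2
  rw [hs.W_eq] at h1 hM h0
  have h2 := trace_exp_update_le hε hε1 hs.posSemidef hM h0 hM h1
  rw [sub_self, frob_zero, add_zero, ← hs.W_eq] at h2
  refine h2.trans ((mul_le_mul_of_nonneg_right hs.trace_le (Real.exp_nonneg _)).trans ?_)
  rw [mul_assoc, ← Real.exp_add, ← mul_add, ← mul_add]
  exact le_rfl

/-- All eigenvalues of `S` are at most `ln tr W ≤ ln m + (1 + ε/6) η α`. While the loop runs, `ε η α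
< 2 ln m`, so `ε ln tr W ≤ (1 + 7/3) ln m`; the parameter `η` cancels. -/
theorem ExactGood.trace_S_lt {η ε : ℝ} (hm : 2 ≤ m) (hη : 0 < η) (hε : 0 < ε) (hε1 : ε < 1)
    {s : State m n} (hs : ExactGood η ε s) (hα : s.α < 2 * Real.log m / (ε * η)) :
    s.S.trace * 6 / ε < 24 * (m : ℝ) ^ 2 / ε ^ 2 := by
  have hm0 : (0 : ℝ) < m := by positivity
  have hlog : Real.log m ≤ m - 1 := Real.log_le_sub_one_of_pos hm0
  have hlog0 : 0 < Real.log m := Real.log_pos (by exact_mod_cast hm)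
  have hsymm := hs.posSemidef.isSymm
  have htr0 : 0 < s.W.trace := by
    have : Nonempty (Fin m) := ⟨⟨0, by omega⟩⟩
    rw [hs.W_eq]
    exact hsymm.posDef_exp.trace_pos
  have hL := Real.log_le_log htr0 hs.trace_le
  rw [Real.log_mul hm0.ne' (Real.exp_pos _).ne', Real.log_exp] at hL
  have htr := hsymm.posSemidef_log_trace_exp_sub.trace_nonneg
  rw [trace_sub, trace_smul, trace_one, Fintype.card_fin, smul_eq_mul, ← hs.W_eq] at htr
  rw [lt_div_iff₀ (by positivity)] at hα
  have h1 : ε * Real.log s.W.trace ≤ 10 / 3 * Real.log m := by nlinarith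
  have h2 : ε * s.S.trace < 4 * (m : ℝ) ^ 2 := by nlinarith
  rw [div_lt_div_iff₀ hε (by positivity)]
  nlinarith

/-- Because `‖M‖ ≤ tr M`, each round adds at least `ε / 6` to `tr S`, that is, at least one to the
scaled potential. -/
theorem sat_run_exact {O : Oracle m n} {B : Matrix (Fin m) (Fin n) ℝ} {p : Fin n → ℝ} {η ε : ℝ}
    (hm : 2 ≤ m) (hη : 0 < η) (hO : IsOracle O B p η) (hε : 0 < ε) (hε1 : ε < 1) {T : ℕ}
    (hT : 24 * (m : ℝ) ^ 2 / ε ^ 2 ≤ T) :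
    (run O B p η ε (exactCov O B p) (T + 1)).Sat fun o c => o.isSome ∧ c.calls ≤ T ∧
      c.steps ≤ T * (m * n + 4 * (m * m) + 3 * n + 13) + 2 * (m * m) + 8 ∧
      c.spectral ≤ 2 * T := by
  have hlog0 : 0 < Real.log m := Real.log_pos (by exact_mod_cast hm)
  refine Comp.Sat.bind (P := fun s c => s = ⟨1, 0, 0, []⟩ ∧ c = ⟨0, 2 * m * m + 2, 0⟩)
    (Comp.sat_op ⟨rfl, rfl⟩) ?_
  rintro _ _ ⟨rfl, rfl⟩
  refine (sat_loop (by positivity) (Good := ExactGood η ε) (pot := fun s => s.S.trace * 6 / ε)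
    (K := 24 * (m : ℝ) ^ 2 / ε ^ 2) (kc := 0) (ks := m * m) (fun s hs => hs.hist) ?_
    (fun s hs => hs.trace_S_lt hm hη hε hε1) T _ ?_ ?_).mono ?_
  · refine fun s hs => Comp.sat_op ⟨fun h0 z => ⟨hs.next hO hε hε1 h0 z, ?_⟩, le_rfl, le_rfl, rfl⟩
    have hM := posSemidef_covB B (O B s.W p)
    set M := covB B (O B s.W p)
    have hν : 0 < opNorm M := lt_of_le_of_ne (opNorm_nonneg M) (Ne.symm h0)
    have hle := opNorm_le_trace hM
    simp only [nextState, trace_add, trace_smul, smul_eq_mul]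
    have : ε / (6 * opNorm M) * M.trace * 6 / ε = M.trace / opNorm M := by field_simp
    rw [add_mul, add_div, this]
    have := (one_le_div hν).2 hle
    linarith
  · exact ⟨⟨by simp, by simp⟩, PosSemidef.zero, by simp, by simp⟩
  · simpa using hT
  · rintro o c ⟨h1, h2, h3, h4⟩
    refine ⟨h1, ?_, ?_, ?_⟩ <;> simp only [Cost.add, List.length_nil] at * <;> nlinarith

/-! ## Empirical covariance matrices in the algorithm -/

theorem sat_run_empirical {O : Oracle m n} {B : Matrix (Fin m) (Fin n) ℝ} {p : Fin n → ℝ}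
    {η ε : ℝ} (hm : 2 ≤ m) (hB : ColumnsLeOne B) (hp : ∀ i, 0 < p i ∧ p i < 1) (hη : 0 < η)
    (hε : 0 < ε) {N : ℕ} (hN : 0 < N) {T : ℕ}
    (hT : 48 * (n : ℝ) ^ 2 * Real.log m / (ε ^ 2 * η) + 1 ≤ T) :
    (run O B p η ε (empiricalCov N O B p) (T + 1)).Sat fun o c => o.isSome ∧
      c.calls ≤ T * (N + 1) ∧
      c.steps ≤ T * (N * (3 * (m * n) + 3 * (m * m) + 5 * n + 1) + m * n + 5 * (m * m) + 3 * n + 14)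
        + 2 * (m * m) + 8 ∧
      c.spectral ≤ 2 * T := by
  have hlog0 : 0 < Real.log m := Real.log_pos (by exact_mod_cast hm)
  refine Comp.Sat.bind (P := fun s c => s = ⟨1, 0, 0, []⟩ ∧ c = ⟨0, 2 * m * m + 2, 0⟩)
    (Comp.sat_op ⟨rfl, rfl⟩) ?_
  rintro _ _ ⟨rfl, rfl⟩
  refine (sat_loop (by positivity) (Good := HistOK) (pot := fun s => s.α * (24 * (n : ℝ) ^ 2 / ε))
    -- The added one keeps the inequality strict when `n = 0` and the potential vanishes
    -- identically.
    (K := 48 * (n : ℝ) ^ 2 * Real.log m / (ε ^ 2 * η) + 1) (kc := N)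
    (ks := 2 * (m * m) + 1 + N * (3 * (m * n) + 3 * (m * m) + 5 * n + 1)) (fun s hs => hs) ?_
    (fun s hs hα => ?_) T _ ?_ ?_).mono ?_
  · intro s hs
    refine (sat_empiricalCov hN O hB hp s.W).mono ?_
    rintro M c ⟨hM, htr, h1, h2, h3⟩
    refine ⟨fun h0 z => ?_, h1.le, h2.le, h3⟩
    have hν : 0 < opNorm M := lt_of_le_of_ne (opNorm_nonneg M) (Ne.symm h0)
    have hle := (opNorm_le_trace hM).trans htr
    refine ⟨hs.cons (by positivity) z _ _, ?_⟩
    simp only [nextState, add_mul]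
    have : ε / (6 * opNorm M) * (24 * (n : ℝ) ^ 2 / ε) = 4 * (n : ℝ) ^ 2 / opNorm M := by
      field_simp; ring
    rw [this]
    have := (one_le_div hν).2 hle
    linarith
  · have h1 := mul_le_mul_of_nonneg_right hα.le (show 0 ≤ 24 * (n : ℝ) ^ 2 / ε by positivity)
    have h2 : 2 * Real.log m / (ε * η) * (24 * (n : ℝ) ^ 2 / ε)
        = 48 * (n : ℝ) ^ 2 * Real.log m / (ε ^ 2 * η) := by field_simp; ring
    linarith
  · exact ⟨by simp, by simp⟩
  · simpa using hT
  · rintro o c ⟨h1, h2, h3, h4⟩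
    refine ⟨h1, ?_, ?_, ?_⟩ <;> simp only [Cost.add, List.length_nil] at * <;> nlinarith

end MWU

end

/-! ### Polynomial bounds with explicit constants. -/

/-- The algorithm with explicit covariance matrices. -/
theorem MWU.exists_returns_exactCov {m n : ℕ} {B : Matrix (Fin m) (Fin n) ℝ} {p : Fin n → ℝ}
    {O : MWU.Oracle m n} {η ε : ℝ} (hm : 2 ≤ m)
    (hp : ∀ i, 0 < p i ∧ p i < 1) (hη : 0 < η) (hO : MWU.IsOracle O B p η) (hε : 0 < ε)
    (hε1 : ε < 1) :
    ∃ ρ : PMF (MWU.Assignment n × MWU.Cost),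
      MWU.Returns O B p η ε (MWU.exactCov O B p) ρ ∧
      MWU.Feasible p (ρ.map Prod.fst) ∧
      MWU.opNorm (MWU.covB B (ρ.map Prod.fst)) ≤ (1 + ε) * η ∧
      ∀ r ∈ ρ.support,
        (r.2.calls : ℝ) ≤ 600 * ((m : ℝ) + n + ε⁻¹) ^ 6 ∧
        ∀ κ : ℕ, (r.2.time κ : ℝ) ≤ 600 * (κ + 1) * ((m : ℝ) + n + ε⁻¹) ^ 6 := by
  obtain ⟨X, hX⟩ : ∃ X : ℝ, X = (m : ℝ) + n + ε⁻¹ := ⟨_, rfl⟩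
  rw [← hX]
  have hm0 : (0 : ℝ) ≤ m := Nat.cast_nonneg m
  have hm1 : (1 : ℝ) ≤ m := by exact_mod_cast (by omega : 1 ≤ m)
  have hn0 : (0 : ℝ) ≤ n := Nat.cast_nonneg n
  have hε0 : 0 < ε⁻¹ := inv_pos.2 hε
  set T := ⌈24 * (m : ℝ) ^ 2 / ε ^ 2⌉₊ with hTdef
  have hT : 24 * (m : ℝ) ^ 2 / ε ^ 2 ≤ T := Nat.le_ceil _
  have hT2 : (T : ℝ) < 24 * (m : ℝ) ^ 2 / ε ^ 2 + 1 := Nat.ceil_lt_add_one (by positivity)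
  obtain ⟨ρ, h1, h2, h3, h4⟩ := MWU.exists_returns hm hp hη hO hε hε1 (ebar := 0) le_rfl
    (cv := MWU.exactCov O B p)
    (fun W _ => MWU.Comp.sat_op (MWU.posSemidef_covB _ _))
    (fun W _ => by simp [MWU.exactCov, MWU.Comp.ev_op, Matrix.frob_zero])
    (by rw [mul_zero, mul_zero]; positivity) (MWU.sat_run_exact hm hη hO hε hε1 hT)
  refine ⟨ρ, h1, h2, h3, fun r hr => ?_⟩
  obtain ⟨c1, c2, c3⟩ := h4 r hr
  have hmX : (m : ℝ) ≤ X := by linarith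
  have hnX : (n : ℝ) ≤ X := by linarith
  have hεX : ε⁻¹ ≤ X := by linarith
  have hX1 : 1 ≤ X := by linarith
  have hX0 : 0 ≤ X := by linarith
  have hTX : (T : ℝ) ≤ 25 * X ^ 4 := by
    have e : 24 * (m : ℝ) ^ 2 / ε ^ 2 = 24 * (m ^ 2 * ε⁻¹ ^ 2) := by
      rw [inv_pow, div_eq_mul_inv]; ring
    have : (m : ℝ) ^ 2 * ε⁻¹ ^ 2 ≤ X ^ 2 * X ^ 2 := by gcongr
    rw [← pow_add] at this
    have h1 : 1 ≤ X ^ 4 := one_le_pow₀ hX1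
    rw [e] at hT2
    linarith
  have hX46 : X ^ 4 ≤ X ^ 6 := pow_le_pow_right₀ hX1 (by norm_num)
  have hX26 : X ^ 2 ≤ X ^ 6 := pow_le_pow_right₀ hX1 (by norm_num)
  have hX12 : X ≤ X ^ 2 := le_self_pow₀ hX1 (by norm_num)
  have hX02 : 1 ≤ X ^ 2 := one_le_pow₀ hX1
  have hmn : (m : ℝ) * n ≤ X ^ 2 := by rw [pow_two]; gcongr
  have hmm : (m : ℝ) * m ≤ X ^ 2 := by rw [pow_two]; gcongr
  have c1' : (r.2.calls : ℝ) ≤ T := by exact_mod_cast c1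
  have c2' : (r.2.steps : ℝ) ≤ T * (m * n + 4 * (m * m) + 3 * n + 13) + 2 * (m * m) + 8 := by
    exact_mod_cast c2
  have c3' : (r.2.spectral : ℝ) ≤ 2 * T := by exact_mod_cast c3
  have hQ : (m : ℝ) * n + 4 * (m * m) + 3 * n + 13 ≤ 21 * X ^ 2 := by linarith
  have hTQ : (T : ℝ) * (m * n + 4 * (m * m) + 3 * n + 13) ≤ 25 * X ^ 4 * (21 * X ^ 2) := by gcongr
  have hX6 : 0 ≤ X ^ 6 := by positivity
  refine ⟨by linarith, fun κ => ?_⟩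
  have hκ : (0 : ℝ) ≤ κ := Nat.cast_nonneg κ
  have e6 : 25 * X ^ 4 * (21 * X ^ 2) = 525 * X ^ 6 := by ring
  have hs : (r.2.steps : ℝ) ≤ 600 * X ^ 6 := by linarith
  have hsp : (κ : ℝ) * r.2.spectral ≤ κ * (600 * X ^ 6) :=
    mul_le_mul_of_nonneg_left (by linarith) hκ
  rw [MWU.Cost.time]
  push_cast
  linarith

/-- The algorithm with empirical covariance matrices. -/
theorem MWU.exists_returns_empiricalCov {m n : ℕ} {B : Matrix (Fin m) (Fin n) ℝ} {p : Fin n → ℝ}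
    {O : MWU.Oracle m n} {η ε : ℝ} (hm : 2 ≤ m) (hB : MWU.ColumnsLeOne B)
    (hp : ∀ i, 0 < p i ∧ p i < 1) (hη : 0 < η) (hO : MWU.IsOracle O B p η) (hε : 0 < ε)
    (hε1 : ε < 1)
    {N : ℕ} (hN : 4000000 * ((m : ℝ) + n + ε⁻¹ + η⁻¹) ^ 20 ≤ N) :
    ∃ ρ : PMF (MWU.Assignment n × MWU.Cost),
      MWU.Returns O B p η ε (MWU.empiricalCov N O B p) ρ ∧
      MWU.Feasible p (ρ.map Prod.fst) ∧
      MWU.opNorm (MWU.covB B (ρ.map Prod.fst)) ≤ (1 + ε) * η ∧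
      ∀ r ∈ ρ.support,
        (r.2.calls : ℝ) ≤ N * (4000000 * ((m : ℝ) + n + ε⁻¹ + η⁻¹) ^ 20) ∧
        ∀ κ : ℕ, (r.2.time κ : ℝ) ≤
          N * (4000000 * (κ + 1) * ((m : ℝ) + n + ε⁻¹ + η⁻¹) ^ 20) := by
  obtain ⟨X, hX⟩ : ∃ X : ℝ, X = (m : ℝ) + n + ε⁻¹ + η⁻¹ := ⟨_, rfl⟩
  rw [← hX] at hN ⊢
  have hm0 : (0 : ℝ) ≤ m := Nat.cast_nonneg m
  have hm1 : (1 : ℝ) ≤ m := by exact_mod_cast (by omega : 1 ≤ m)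
  have hn0 : (0 : ℝ) ≤ n := Nat.cast_nonneg n
  have hε0 : 0 < ε⁻¹ := inv_pos.2 hε
  have hη0 : 0 < η⁻¹ := inv_pos.2 hη
  have hlog0 : 0 ≤ Real.log m := Real.log_nonneg hm1
  have hlog : Real.log m ≤ m := (Real.log_le_sub_one_of_pos (by linarith)).trans (by linarith)
  have hmX : (m : ℝ) ≤ X := by linarith
  have hnX : (n : ℝ) ≤ X := by linarith
  have hεX : ε⁻¹ ≤ X := by linarith
  have hηX : η⁻¹ ≤ X := by linarith
  have hX1 : 1 ≤ X := by linarith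
  have hX0 : 0 < X := by linarith
  have hN1 : (1 : ℝ) ≤ N := by
    have : 1 ≤ X ^ 20 := one_le_pow₀ hX1
    linarith
  have hN0 : 0 < N := by exact_mod_cast hN1
  set T := ⌈48 * (n : ℝ) ^ 2 * Real.log m / (ε ^ 2 * η) + 1⌉₊ with hTdef
  have hT : 48 * (n : ℝ) ^ 2 * Real.log m / (ε ^ 2 * η) + 1 ≤ T := Nat.le_ceil _
  have hT2 : (T : ℝ) < 48 * (n : ℝ) ^ 2 * Real.log m / (ε ^ 2 * η) + 1 + 1 :=
    Nat.ceil_lt_add_one (by positivity)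
  have hX61 : 1 ≤ X ^ 6 := one_le_pow₀ hX1
  have hTX : (T : ℝ) ≤ 50 * X ^ 6 := by
    have e : 48 * (n : ℝ) ^ 2 * Real.log m / (ε ^ 2 * η)
        = 48 * ((n : ℝ) ^ 2 * Real.log m * (ε⁻¹ ^ 2 * η⁻¹)) := by
      rw [inv_pow, div_eq_mul_inv, mul_inv]; ring
    have : (n : ℝ) ^ 2 * Real.log m * (ε⁻¹ ^ 2 * η⁻¹) ≤ X ^ 2 * X * (X ^ 2 * X) := by
      gcongr
      exact hlog.trans hmX
    have e6 : X ^ 2 * X * (X ^ 2 * X) = X ^ 6 := by ring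
    rw [e] at hT2
    linarith
  have hεX' : 1 ≤ ε * X := by
    calc 1 = ε * ε⁻¹ := (mul_inv_cancel₀ hε.ne').symm
      _ ≤ ε * X := by gcongr
  have hηX' : 1 ≤ η * X := by
    calc 1 = η * η⁻¹ := (mul_inv_cancel₀ hη.ne').symm
      _ ≤ η * X := by gcongr
  -- The error allowed per round is chosen so that `T + 1` rounds use up exactly the slack. Here `9
  -- (T + 1) ≤ 9 · 51 X⁶ = 459 X⁶`, and `ε`, `η` cost one factor `X` each.
  have hδle : 1 / (459 * X ^ 8) ≤ ε * η / (9 * (T + 1)) := by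
    rw [div_le_div_iff₀ (by positivity) (by positivity), one_mul]
    calc 9 * ((T : ℝ) + 1) ≤ 459 * X ^ 6 := by linarith
      _ ≤ 459 * X ^ 6 * ((ε * X) * (η * X)) :=
        le_mul_of_one_le_right (by positivity) (one_le_mul_of_one_le_of_one_le hεX' hηX')
      _ = ε * η * (459 * X ^ 8) := by ring
  -- This fixes the exponent and the constant: `16 X⁴ · (459 X⁸)² = 3370896 X²⁰ ≤ 4000000 X²⁰`.
  have hδN : 16 * (n : ℝ) ^ 4 ≤ (ε * η / (9 * (T + 1))) ^ 2 * N := by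
    calc 16 * (n : ℝ) ^ 4 ≤ 16 * X ^ 4 := by gcongr
      _ ≤ (1 / (459 * X ^ 8)) ^ 2 * (4000000 * X ^ 20) := by
        have : (1 / (459 * X ^ 8)) ^ 2 * (4000000 * X ^ 20) = 4000000 / 459 ^ 2 * X ^ 4 := by
          field_simp
        rw [this]
        gcongr
        norm_num
      _ ≤ _ := by gcongr
  obtain ⟨ρ, h1, h2, h3, h4⟩ := MWU.exists_returns hm hp hη hO hε hε1
    (ebar := ε * η / (9 * (T + 1))) (by positivity) (cv := MWU.empiricalCov N O B p)
    (fun W _ => (MWU.sat_empiricalCov hN0 O hB hp W).mono fun _ _ h => h.1)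
    (fun W hW => MWU.ev_empiricalCov_le hB hp (hO W hW).1 (by positivity) hN0 hδN)
    (by push_cast; refine le_of_eq ?_; field_simp)
    (MWU.sat_run_empirical hm hB hp hη hε hN0 hT)
  refine ⟨ρ, h1, h2, h3, fun r hr => ?_⟩
  obtain ⟨c1, c2, c3⟩ := h4 r hr
  have hX6 : X ^ 6 ≤ X ^ 20 := pow_le_pow_right₀ hX1 (by norm_num)
  have hX8 : X ^ 8 ≤ X ^ 20 := pow_le_pow_right₀ hX1 (by norm_num)
  have hX2 : X ^ 2 ≤ X ^ 20 := pow_le_pow_right₀ hX1 (by norm_num)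
  have hX12 : X ≤ X ^ 2 := le_self_pow₀ hX1 (by norm_num)
  have hX02 : 1 ≤ X ^ 2 := one_le_pow₀ hX1
  have hmn : (m : ℝ) * n ≤ X ^ 2 := by rw [pow_two]; gcongr
  have hmm : (m : ℝ) * m ≤ X ^ 2 := by rw [pow_two]; gcongr
  have c1' : (r.2.calls : ℝ) ≤ T * (N + 1) := by exact_mod_cast c1
  have c2' : (r.2.steps : ℝ) ≤ T * (N * (3 * (m * n) + 3 * (m * m) + 5 * n + 1) + m * n
      + 5 * (m * m) + 3 * n + 14) + 2 * (m * m) + 8 := by exact_mod_cast c2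
  have c3' : (r.2.spectral : ℝ) ≤ 2 * T := by exact_mod_cast c3
  have hNX : ∀ a : ℝ, 0 ≤ a → a ≤ N * a := fun a ha => le_mul_of_one_le_left ha hN1
  have hQ : (N : ℝ) * (3 * (m * n) + 3 * (m * m) + 5 * n + 1) + m * n + 5 * (m * m) + 3 * n + 14
      ≤ N * (35 * X ^ 2) := by
    have h1 : (N : ℝ) * (3 * (m * n) + 3 * (m * m) + 5 * n + 1) ≤ N * (12 * X ^ 2) := by
      gcongr; linarith
    have h2 := hNX (23 * X ^ 2) (by positivity)
    linarith
  have hTQ : (T : ℝ) * (N * (3 * (m * n) + 3 * (m * m) + 5 * n + 1) + m * n + 5 * (m * m)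
      + 3 * n + 14) ≤ 50 * X ^ 6 * (N * (35 * X ^ 2)) := by gcongr
  have hNX8 : (N : ℝ) * X ^ 8 ≤ N * X ^ 20 := by gcongr
  have hNX2 : (N : ℝ) * X ^ 2 ≤ N * X ^ 20 := by gcongr
  have hNX6 : (N : ℝ) * X ^ 6 ≤ N * X ^ 20 := by gcongr
  have hNX20 : (0 : ℝ) ≤ N * X ^ 20 := by positivity
  refine ⟨?_, fun κ => ?_⟩
  · have : (T : ℝ) * (N + 1) ≤ 50 * X ^ 6 * (N + N) := by gcongr
    linarith
  · have hκ : (0 : ℝ) ≤ κ := Nat.cast_nonneg κ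
    have hs : (r.2.steps : ℝ) ≤ 4000000 * (N * X ^ 20) := by
      have := hNX (10 * X ^ 2) (by positivity)
      have e : 50 * X ^ 6 * (N * (35 * X ^ 2)) = 1750 * (N * X ^ 8) := by ring
      linarith
    have hsp : (κ : ℝ) * r.2.spectral ≤ κ * (4000000 * (N * X ^ 20)) := by
      refine mul_le_mul_of_nonneg_left ?_ hκ
      have := hNX (X ^ 6) (by positivity)
      linarith
    rw [MWU.Cost.time]
    push_cast
    linarith

theorem theorem3 :
    -- explicit covariance matrices
    (∃ C k : ℕ, ∀ (m n : ℕ) (B : Matrix (Fin m) (Fin n) ℝ) (p : Fin n → ℝ)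
        (O : MWU.Oracle m n) (η ε : ℝ),
      2 ≤ m → MWU.ColumnsLeOne B → (∀ i, 0 < p i ∧ p i < 1) → 0 < η → MWU.IsOracle O B p η →
      0 < ε → ε < 1 →
      ∃ ρ : PMF (MWU.Assignment n × MWU.Cost),
        MWU.Returns O B p η ε (MWU.exactCov O B p) ρ ∧
        MWU.Feasible p (ρ.map Prod.fst) ∧
        MWU.opNorm (MWU.covB B (ρ.map Prod.fst)) ≤ (1 + ε) * η ∧
        ∀ r ∈ ρ.support,
          (r.2.calls : ℝ) ≤ C * ((m : ℝ) + n + ε⁻¹) ^ k ∧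
          ∀ κ : ℕ, (r.2.time κ : ℝ) ≤ C * (κ + 1) * ((m : ℝ) + n + ε⁻¹) ^ k) ∧
    -- covariance matrices estimated from `N` independent samples
    (∃ C k : ℕ, ∀ (m n : ℕ) (B : Matrix (Fin m) (Fin n) ℝ) (p : Fin n → ℝ)
        (O : MWU.Oracle m n) (η ε : ℝ),
      2 ≤ m → MWU.ColumnsLeOne B → (∀ i, 0 < p i ∧ p i < 1) → 0 < η → MWU.IsOracle O B p η →
      0 < ε → ε < 1 →
      ∀ N : ℕ, C * ((m : ℝ) + n + ε⁻¹ + η⁻¹) ^ k ≤ N →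
      ∃ ρ : PMF (MWU.Assignment n × MWU.Cost),
        MWU.Returns O B p η ε (MWU.empiricalCov N O B p) ρ ∧
        MWU.Feasible p (ρ.map Prod.fst) ∧
        MWU.opNorm (MWU.covB B (ρ.map Prod.fst)) ≤ (1 + ε) * η ∧
        ∀ r ∈ ρ.support,
          (r.2.calls : ℝ) ≤ N * (C * ((m : ℝ) + n + ε⁻¹ + η⁻¹) ^ k) ∧
          ∀ κ : ℕ, (r.2.time κ : ℝ) ≤
            N * (C * (κ + 1) * ((m : ℝ) + n + ε⁻¹ + η⁻¹) ^ k)) := by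
  refine ⟨⟨600, 6, ?_⟩, ⟨4000000, 20, ?_⟩⟩
  · intro m n B p O η ε hm _ hp hη hO hε hε1
    simp only [Nat.cast_ofNat]
    exact MWU.exists_returns_exactCov hm hp hη hO hε hε1
  · intro m n B p O η ε hm hB hp hη hO hε hε1 N hN
    simp only [Nat.cast_ofNat] at hN ⊢
    exact MWU.exists_returns_empiricalCov hm hB hp hη hO hε hε1 hN
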